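/- Consider equations $$y''=P(x,y)+3\,Q(x,y)\,y'+3\,R(x,y)\,(y')^2+S(x,y)\,(y')^3$$ with coefficients smooth on an open set $U\subset\mathbb R^2$; write $f_{p.q}=\partial^{p+q}f/\partial x^p\partial y^q$, $x^1=x$, $x^2=y$, and $d^{12}=1$, $d^{21}=-1$, $d^{11}=d^{22}=0$. **Sharipov's fields.** Put $$A=P_{0.2}-2Q_{1.1}+R_{2.0}+2PS_{1.0}+SP_{1.0}-3PR_{0.1}-3RP_{0.1}-3QR_{1.0}+6QQ_{0.1},$$ $$B=S_{2.0}-2R_{1.1}+Q_{0.2}-2SP_{0.1}-PS_{0.1}+3SQ_{1.0}+3QS_{1.0}+3RQ_{0.1}-6RR_{1.0},$$ $$G=-BB_{1.0}-3AB_{0.1}+4BA_{0.1}+3SA^2-6RAB+3QB^2,$$ $$H=-AA_{0.1}-3BA_{1.0}+4AB_{1.0}-3PB^2+6QAB-3RA^2,$$ $\boldsymbol\alpha=(A,B)$ and $3F^5=AG+BH$. If $F=0$ and $\boldsymbol\alpha\ne0$, the following fields are defined, where $A\neq0$, by $$N=-\frac{H}{3A},\quad \varphi_1=-3\,\frac{BP+A_{1.0}}{5A}+\frac35Q,\quad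 \varphi_2=3B\,\frac{BP+A_{1.0}}{5A^2}-3\,\frac{B_{1.0}+A_{0.1}+3BQ}{5A}+\frac65R,$$ $$M=-\frac{12BN(BP+A_{1.0})}{5A}+BN_{1.0}+\frac{24}5BNQ+\frac65N(B_{1.0}+A_{0.1})-AN_{0.1}-\frac{12}5ANR,$$ $$\Omega=\frac53\Bigl(\frac{\partial\varphi_1}{\partial y}-\frac{\partial\varphi_2}{\partial x}\Bigr),\qquad \gamma_1=\frac{6N(BP+A_{1.0})}{5A}-N_{1.0}-\frac65NQ-2\Omega A,$$ $$\gamma_2=-\frac{6BN(BP+A_{1.0})}{5A^2}+\frac{18NBQ}{5A}+\frac{6N(B_{1.0}+A_{0.1})}{5A}-N_{0.1}-\frac{12}5NR-2\Omega B,$$ and, where $B\ne0$, by $$N=\frac{G}{3B},\quad \varphi_1=-3A\,\frac{AS-B_{0.1}}{5B^2}-3\,\frac{A_{0.1}+B_{1.0}-3AR}{5B}-\frac65Q,\quad \varphi_2=3\,\frac{AS-B_{0.1}}{5B}-\frac35R,$$ $$M=-\frac{12AN(AS-B_{0.1})}{5B}-AN_{0.1}+\frac{24}5ANR-\frac65N(A_{0.1}+B_{1.0})+BN_{1.0}-\frac{12}5BNQ,$$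 $$\gamma_1=\frac{6AN(AS-B_{0.1})}{5B^2}-\frac{18NAR}{5B}+\frac{6N(A_{0.1}+B_{1.0})}{5B}-N_{1.0}+\frac{12}5NQ-2\Omega A,$$ $$\gamma_2=-\frac{6N(AS-B_{0.1})}{5B}-N_{0.1}+\frac65NR-2\Omega B,$$ with $\Omega$ given by the same formula in $\varphi_1,\varphi_2$. Let $\alpha^i=\sum_k d^{ik}\alpha_k$ and $\gamma^i=\sum_k d^{ik}\gamma_k$ (pseudovectorial fields of weights $2$ and $3$). Let $\theta^1_{11}=Q$, $\theta^1_{12}=\theta^1_{21}=R$, $\theta^1_{22}=S$, $\theta^2_{11}=-P$, $\theta^2_{12}=\theta^2_{21}=-Q$, $\theta^2_{22}=-R$, and $\varGamma^k_{ij}=\theta^k_{ij}-\frac13(\varphi_i\delta^k_j+\varphi_j\delta^k_i)$. For a pseudovectorial field $X$ of weight $m$ put $\nabla_kX^i=\partial_kX^i+\sum_v\varGamma^i_{kv}X^v+m\varphi_kX^i$; for scalars $\nabla_k=\partial_k$. Put $\nabla_{\boldsymbol\alpha}=\sum_k\alpha^k\nabla_k$ and $\nabla_{\boldsymbol\gamma}=\sum_k\gamma^k\nabla_k$.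 When $M\neq0$, $\boldsymbol\alpha$ and $\boldsymbol\gamma$ are linearly independent, and $\Gamma^1_{22},\Gamma^2_{22}$ are defined by $\nabla_{\boldsymbol\gamma}\boldsymbol\gamma=\Gamma^1_{22}\boldsymbol\alpha+\Gamma^2_{22}\boldsymbol\gamma$. **Sharipov's invariants.** When $M\neq 0$ and $N\ne0$ put $I_1=M/N^2$, $I_2=\Omega^2/N$, $I_3=\Gamma^1_{22}N^2/M^2$. Let $T_0=(I_1,I_2,I_3)$ and, for $n\ge0$, obtain the triple $T_{2n+1}$ from $T_n$ by applying $J\mapsto\nabla_{\boldsymbol\alpha}J/N$, and $T_{2n+2}$ from $T_n$ by applying $J\mapsto(\nabla_{\boldsymbol\gamma}J)^2/N^3$, to each member; $T_n=(I_{3n+1},I_{3n+2},I_{3n+3})$. So $I_4=\nabla_{\boldsymbol\alpha}I_1/N$, $I_7=(\nabla_{\boldsymbol\gamma}I_1)^2/N^3$, and so on. **Bagderina's invariant.** Put $$a_0=Q_{1.0}-P_{0.1}+2PR-2Q^2,\quad a_1=R_{1.0}-Q_{0.1}+PS-QR,\quad a_2=S_{1.0}-R_{0.1}+2QS-2R^2,$$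 $$b_1=\partial_xa_1-\partial_ya_0+Ra_0-2Qa_1+Pa_2,\quad b_2=\partial_xa_2-\partial_ya_1+Sa_0-2Ra_1+Qa_2$$ (so $b_1=A$, $b_2=B$), $$c_{10}=\partial_xb_1-Qb_1+Pb_2,\quad c_{11}=\partial_xb_2-Rb_1+Qb_2,\quad c_{20}=\partial_yb_1-Rb_1+Qb_2,\quad c_{21}=\partial_yb_2-Sb_1+Rb_2,$$ $$d_{10}=\partial_xc_{10}-2Qc_{10}+P(c_{20}+c_{11})-5a_0b_1,\quad d_{20}=\partial_xc_{20}-Rc_{10}+Pc_{21}-4a_1b_1-a_0b_2,$$ $$d_{30}=\partial_yc_{20}-Sc_{10}+Qc_{21}-4a_2b_1-a_1b_2,\quad d_{11}=\partial_xc_{11}-Rc_{10}+Pc_{21}-a_1b_1-4a_0b_2,$$ and, where $b_1\ne0$, $$j_0=\frac3{b_1}\Bigl(\frac{b_2}{b_1}d_{10}-d_{11}\Bigr)+\frac{6c_{10}}{b_1^2}\Bigl(c_{11}-\frac{b_2}{b_1}c_{10}\Bigr),$$ $$j_1=\frac56\Bigl(2b_2d_{20}-b_1d_{30}-\frac{b_2^2}{b_1}d_{10}\Bigr)+\Bigl(c_{20}-\frac23c_{11}-\frac{b_2}{3b_1}c_{10}\Bigr)\Bigl(c_{20}+c_{11}-2\frac{b_2}{b_1}c_{10}\Bigr),$$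 $$j_2=\frac1{b_1}\Bigl(d_{20}-\frac{b_2}{b_1}d_{10}\Bigr)+\frac{c_{10}}{5b_1^2}\Bigl(7\frac{b_2}{b_1}c_{10}-6c_{20}-c_{11}\Bigr),\quad j_3=\frac35\Bigl(\frac{d_{10}}{b_1^3}-\frac{6c_{10}^2}{5b_1^4}\Bigr),$$ $$j_5=5\bigl(2j_1j_3+(j_2-j_0/6)^2\bigr),\qquad I_2^{\mathrm{Bgd}}=\frac{j_5}{j_0^2}.$$ **Theorem.** The invariant $I_2^{\mathrm{Bgd}}$ can be expressed through the invariants $I_1,I_2,I_3,I_4,\dots$ by universal formulas. Precisely, there are two formal expressions $e_1,e_2$ in variables $X_1,X_2,\dots$, built from rational constants by addition, multiplication, reciprocals and square roots and independent of the equation, such that the following holds for every equation and every open $U$ as above that lie in the intersection class $\mathrm{ShrID1}\cap\mathrm{BgdET2}$, i.e. satisfy $$F=0,\quad\boldsymbol\alpha\neq0,\quad M\neq0,\quad\Omega\neq0,\quad N\neq0\qquad\text{at all points of }U.$$ Let $D=\{p\in U: b_1(p)\ne0\}$, $D_1=\{p\in D: I_7(p)\neq0\}$, and let $D_2$ be the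 interior of $\{p\in D: I_7(p)=0\}$. Then 1. on $D$, $j_0\ne0$, $I_2^{\mathrm{Bgd}}=j_5/(9\,\Omega^2)$, and $I_2^{\mathrm{Bgd}}$ is continuous; the set $D_1\cup D_2$ is dense in $D$; 2. on $D_1$, $I_2^{\mathrm{Bgd}}$ is a value of $e_1$ at $X_k=I_k$; 3. on $D_2$, $I_2^{\mathrm{Bgd}}$ is a value of $e_2$ at $X_k=I_k$. Here, in evaluating an expression on a set $W$, a reciprocal is taken only of a function without zeros on $W$, and a square root of a function $f$ means some continuous function on $W$ whose square is $f$. -/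

import Mathlib

/-- Functions of the two independent variables `(x, y)`. -/
abbrev PlaneField : Type := ℝ × ℝ → ℝ

noncomputable section

/-- The partial derivative `∂f/∂x`. -/
def pdx (f : PlaneField) : PlaneField := fun p => fderiv ℝ f p (1, 0)

/-- The partial derivative `∂f/∂y`. -/
def pdy (f : PlaneField) : PlaneField := fun p => fderiv ℝ f p (0, 1)

/-- The partial derivative `∂f/∂xⁱ`, where `x⁰ = x` and `x¹ = y` (indices start from `0`). -/
def pd (i : Fin 2) (f : PlaneField) : PlaneField := if i = 0 then pdx f else pdy f

/-- The skew-symmetric matrix `d` with constant components, used for raising indices. -/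
def dMat : Matrix (Fin 2) (Fin 2) ℝ := !![0, 1; -1, 0]

/-- The equation `y'' = P(x,y) + 3 Q(x,y) y' + 3 R(x,y) (y')² + S(x,y) (y')³`,
given by its coefficients. -/
structure CubicODE where
  P : PlaneField
  Q : PlaneField
  R : PlaneField
  S : PlaneField

namespace CubicODE

variable (E : CubicODE)

/-- The coefficients of the equation are smooth on `U`. -/
def SmoothOn (U : Set (ℝ × ℝ)) : Prop :=
  ContDiffOn ℝ (⊤ : ℕ∞) E.P U ∧ ContDiffOn ℝ (⊤ : ℕ∞) E.Q U ∧
    ContDiffOn ℝ (⊤ : ℕ∞) E.R U ∧ ContDiffOn ℝ (⊤ : ℕ∞) E.S U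

/-! ### The fields `α`, `β` and `F` -/

/-- `A = α₁`. -/
def A : PlaneField := fun p =>
  pdy (pdy E.P) p - 2 * pdx (pdy E.Q) p + pdx (pdx E.R) p
    + 2 * E.P p * pdx E.S p + E.S p * pdx E.P p
    - 3 * E.P p * pdy E.R p - 3 * E.R p * pdy E.P p
    - 3 * E.Q p * pdx E.R p + 6 * E.Q p * pdy E.Q p

/-- `B = α₂`. -/
def B : PlaneField := fun p =>
  pdx (pdx E.S) p - 2 * pdx (pdy E.R) p + pdy (pdy E.Q) p
    - 2 * E.S p * pdy E.P p - E.P p * pdy E.S p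
    + 3 * E.S p * pdx E.Q p + 3 * E.Q p * pdx E.S p
    + 3 * E.R p * pdy E.Q p - 6 * E.R p * pdx E.R p

/-- `G = β₂`. -/
def G : PlaneField := fun p =>
  -E.B p * pdx E.B p - 3 * E.A p * pdy E.B p + 4 * E.B p * pdy E.A p
    + 3 * E.S p * E.A p ^ 2 - 6 * E.R p * E.B p * E.A p + 3 * E.Q p * E.B p ^ 2

/-- `H = -β₁`. -/
def H : PlaneField := fun p =>
  -E.A p * pdy E.A p - 3 * E.B p * pdx E.A p + 4 * E.A p * pdx E.B p
    - 3 * E.P p * E.B p ^ 2 + 6 * E.Q p * E.A p * E.B p - 3 * E.R p * E.A p ^ 2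

/-- The pseudoscalar field `F`, the real fifth root given by `3 F⁵ = A G + B H`. -/
def F : PlaneField := fun p =>
  Real.sign ((E.A p * E.G p + E.B p * E.H p) / 3) *
    |(E.A p * E.G p + E.B p * E.H p) / 3| ^ (1 / 5 : ℝ)

theorem F_pow_five (p : ℝ × ℝ) : 3 * E.F p ^ 5 = E.A p * E.G p + E.B p * E.H p := by
  have key : ∀ t : ℝ, (Real.sign t * |t| ^ (1 / 5 : ℝ)) ^ 5 = t := by
    intro t
    have h1 : (|t| ^ (1 / 5 : ℝ)) ^ 5 = |t| := by
      rw [← Real.rpow_natCast, ← Real.rpow_mul (abs_nonneg t)]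
      norm_num
    rw [mul_pow, h1]
    rcases lt_trichotomy t 0 with h | h | h
    · rw [Real.sign_of_neg h, abs_of_neg h]; ring
    · subst h; simp
    · rw [Real.sign_of_pos h, abs_of_pos h]; ring
  rw [F, key]
  ring

/-! ### Fields of the cases of intermediate degeneration

Each of these fields is given by one formula where `A ≠ 0` and by another one where `B ≠ 0`; if
`F = 0` on an open set, the two formulas agree where both apply. -/

/-- The pseudoscalar field `N` of weight `2`, given by `β = 3 N α`. -/
def N : PlaneField := fun p =>
  if E.A p ≠ 0 then -E.H p / (3 * E.A p) else E.G p / (3 * E.B p)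

/-- The quantity `φ₁`. -/
def phi1 : PlaneField := fun p =>
  if E.A p ≠ 0 then
    -3 * (E.B p * E.P p + pdx E.A p) / (5 * E.A p) + 3 / 5 * E.Q p
  else
    -3 * E.A p * (E.A p * E.S p - pdy E.B p) / (5 * E.B p ^ 2)
      - 3 * (pdy E.A p + pdx E.B p - 3 * E.A p * E.R p) / (5 * E.B p) - 6 / 5 * E.Q p

/-- The quantity `φ₂`. -/
def phi2 : PlaneField := fun p =>
  if E.A p ≠ 0 then
    3 * E.B p * (E.B p * E.P p + pdx E.A p) / (5 * E.A p ^ 2)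
      - 3 * (pdx E.B p + pdy E.A p + 3 * E.B p * E.Q p) / (5 * E.A p) + 6 / 5 * E.R p
  else
    3 * (E.A p * E.S p - pdy E.B p) / (5 * E.B p) - 3 / 5 * E.R p

/-- The pair `(φ₁, φ₂)`. -/
def phi (i : Fin 2) : PlaneField := if i = 0 then E.phi1 else E.phi2

/-- `ω_{ij} = ∂φ_i/∂xʲ - ∂φ_j/∂xⁱ`. -/
def omega (i j : Fin 2) : PlaneField := fun p => pd j (E.phi i) p - pd i (E.phi j) p

/-- The pseudoscalar field `Ω = (5/6) ∑ ω_{ij} d^{ij}` of weight `1`. -/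
def Om : PlaneField := fun p => 5 / 6 * ∑ i, ∑ j, E.omega i j p * dMat i j

/-- The pseudoscalar field `M` of weight `4`. -/
def M : PlaneField := fun p =>
  if E.A p ≠ 0 then
    -(12 * E.B p * E.N p * (E.B p * E.P p + pdx E.A p)) / (5 * E.A p)
      + E.B p * pdx E.N p + 24 / 5 * E.B p * E.N p * E.Q p
      + 6 / 5 * E.N p * pdx E.B p + 6 / 5 * E.N p * pdy E.A p
      - E.A p * pdy E.N p - 12 / 5 * E.A p * E.N p * E.R p
  else
    -(12 * E.A p * E.N p * (E.A p * E.S p - pdy E.B p)) / (5 * E.B p)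
      - E.A p * pdy E.N p + 24 / 5 * E.A p * E.N p * E.R p
      - 6 / 5 * E.N p * pdy E.A p - 6 / 5 * E.N p * pdx E.B p
      + E.B p * pdx E.N p - 12 / 5 * E.B p * E.N p * E.Q p

/-- The component `γ₁` of the pseudocovectorial field `γ` of weight `2`. -/
def gamma1 : PlaneField := fun p =>
  if E.A p ≠ 0 then
    6 * E.N p * (E.B p * E.P p + pdx E.A p) / (5 * E.A p)
      - pdx E.N p - 6 / 5 * E.N p * E.Q p - 2 * E.Om p * E.A p
  else
    6 * E.A p * E.N p * (E.A p * E.S p - pdy E.B p) / (5 * E.B p ^ 2)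
      - 18 * E.N p * E.A p * E.R p / (5 * E.B p)
      + 6 * E.N p * (pdy E.A p + pdx E.B p) / (5 * E.B p)
      - pdx E.N p + 12 / 5 * E.N p * E.Q p - 2 * E.Om p * E.A p

/-- The component `γ₂` of the pseudocovectorial field `γ` of weight `2`. -/
def gamma2 : PlaneField := fun p =>
  if E.A p ≠ 0 then
    -(6 * E.B p * E.N p * (E.B p * E.P p + pdx E.A p)) / (5 * E.A p ^ 2)
      + 18 * E.N p * E.B p * E.Q p / (5 * E.A p)
      + 6 * E.N p * (pdx E.B p + pdy E.A p) / (5 * E.A p)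
      - pdy E.N p - 12 / 5 * E.N p * E.R p - 2 * E.Om p * E.B p
  else
    -(6 * E.N p * (E.A p * E.S p - pdy E.B p)) / (5 * E.B p)
      - pdy E.N p + 6 / 5 * E.N p * E.R p - 2 * E.Om p * E.B p

/-- The pseudocovectorial field `α` of weight `1`. -/
def alphaDown (i : Fin 2) : PlaneField := if i = 0 then E.A else E.B

/-- The pseudocovectorial field `γ` of weight `2`. -/
def gammaDown (i : Fin 2) : PlaneField := if i = 0 then E.gamma1 else E.gamma2

/-- The pseudovectorial field `αⁱ = ∑ d^{ik} α_k` of weight `2`. -/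
def alphaUp (i : Fin 2) : PlaneField := fun p => ∑ k, dMat i k * E.alphaDown k p

/-- The pseudovectorial field `γⁱ = ∑ d^{ik} γ_k` of weight `3`. -/
def gammaUp (i : Fin 2) : PlaneField := fun p => ∑ k, dMat i k * E.gammaDown k p

/-! ### The connection and covariant derivatives -/

/-- The symmetric array `Θ_{ijk}` with `Θ₁₁₁ = P`, `Θ₁₁₂ = Q`, `Θ₁₂₂ = R`, `Θ₂₂₂ = S`. -/
def Theta (i j k : Fin 2) : PlaneField :=
  match i.val + j.val + k.val with
  | 0 => E.P
  | 1 => E.Q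
  | 2 => E.R
  | _ => E.S

/-- `θ^k_{ij} = ∑ d^{kr} Θ_{rij}`. -/
def theta (k i j : Fin 2) : PlaneField := fun p => ∑ r, dMat k r * E.Theta r i j p

/-- The connection components `Γ^k_{ij} = θ^k_{ij} - (φ_i δ^k_j + φ_j δ^k_i) / 3`. -/
def conn (k i j : Fin 2) : PlaneField := fun p =>
  E.theta k i j p
    - ((if k = j then E.phi i p else 0) + (if k = i then E.phi j p else 0)) / 3

/-- The covariant derivative `∇_k f` of a pseudoscalar field `f` of weight `m`. -/
def covScalar (m : ℝ) (k : Fin 2) (f : PlaneField) : PlaneField := fun p =>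
  pd k f p + m * E.phi k p * f p

/-- The `i`-th component of the covariant derivative `∇_k X` of a pseudovectorial field `X` of
weight `m`. -/
def covVector (m : ℝ) (k : Fin 2) (X : Fin 2 → PlaneField) (i : Fin 2) : PlaneField := fun p =>
  pd k (X i) p + ∑ v, E.conn i k v p * X v p + m * E.phi k p * X i p

/-- `∇_Z f` for a pseudoscalar field `f` of weight `m` along a pseudovectorial field `Z`. -/
def covScalarAlong (m : ℝ) (Z : Fin 2 → PlaneField) (f : PlaneField) : PlaneField := fun p =>
  ∑ k, Z k p * E.covScalar m k f p

/-- `∇_Z X` for a pseudovectorial field `X` of weight `m` along a pseudovectorial field `Z`. -/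
def covVectorAlong (m : ℝ) (Z X : Fin 2 → PlaneField) (i : Fin 2) : PlaneField := fun p =>
  ∑ k, Z k p * E.covVector m k X i p

/-- The coefficient `Γ¹₂₂` of the expansion `∇_γ γ = Γ¹₂₂ α + Γ²₂₂ γ`, by Cramer's rule. -/
def Gamma122 : PlaneField := fun p =>
  (E.covVectorAlong 3 E.gammaUp E.gammaUp 0 p * E.gammaUp 1 p
      - E.covVectorAlong 3 E.gammaUp E.gammaUp 1 p * E.gammaUp 0 p)
    / (E.alphaUp 0 p * E.gammaUp 1 p - E.alphaUp 1 p * E.gammaUp 0 p)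

/-! ### The sequence of scalar invariants -/

/-- The basic triple: `I₁ = M / N²`, `I₂ = Ω² / N`, `I₃ = Γ¹₂₂ N² / M²`. -/
def basicTriple (r : Fin 3) : PlaneField :=
  match r with
  | 0 => fun p => E.M p / E.N p ^ 2
  | 1 => fun p => E.Om p ^ 2 / E.N p
  | 2 => fun p => E.Gamma122 p * E.N p ^ 2 / E.M p ^ 2

/-- `J ↦ ∇_α J / N` on scalar invariants. -/
def stepAlpha (J : PlaneField) : PlaneField := fun p =>
  E.covScalarAlong 0 E.alphaUp J p / E.N p

/-- `J ↦ (∇_γ J)² / N³` on scalar invariants. -/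
def stepGamma (J : PlaneField) : PlaneField := fun p =>
  E.covScalarAlong 0 E.gammaUp J p ^ 2 / E.N p ^ 3

/-- The triples of invariants `T₀ = (I₁, I₂, I₃)`, `T₁ = (I₄, I₅, I₆)`, `T₂ = (I₇, I₈, I₉)`, …
Every triple `T_n` produces two more, `T_{2n+1}` by `J ↦ ∇_α J / N` and `T_{2n+2}` by
`J ↦ (∇_γ J)² / N³`; every triple except `T₀` arises exactly once. -/
def triple : ℕ → Fin 3 → PlaneField
  | 0 => E.basicTriple
  | n + 1 => fun r =>
      if n % 2 = 0 then E.stepAlpha (triple (n / 2) r) else E.stepGamma (triple (n / 2) r)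
  decreasing_by all_goals omega

/-- The invariant `I_k`, `k ≥ 1` (the index `0` repeats `I₁`). -/
def I (k : ℕ) : PlaneField := E.triple ((k - 1) / 3) (Fin.ofNat 3 (k - 1))

/-! ### Bagderina's quantities -/

def a0 : PlaneField := fun p =>
  pdx E.Q p - pdy E.P p + 2 * E.P p * E.R p - 2 * E.Q p ^ 2

def a1 : PlaneField := fun p =>
  pdx E.R p - pdy E.Q p + E.P p * E.S p - E.Q p * E.R p

def a2 : PlaneField := fun p =>
  pdx E.S p - pdy E.R p + 2 * E.Q p * E.S p - 2 * E.R p ^ 2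

def b1 : PlaneField := fun p =>
  pdx E.a1 p - pdy E.a0 p + E.R p * E.a0 p - 2 * E.Q p * E.a1 p + E.P p * E.a2 p

def b2 : PlaneField := fun p =>
  pdx E.a2 p - pdy E.a1 p + E.S p * E.a0 p - 2 * E.R p * E.a1 p + E.Q p * E.a2 p

def c10 : PlaneField := fun p => pdx E.b1 p - E.Q p * E.b1 p + E.P p * E.b2 p

def c11 : PlaneField := fun p => pdx E.b2 p - E.R p * E.b1 p + E.Q p * E.b2 p

def c20 : PlaneField := fun p => pdy E.b1 p - E.R p * E.b1 p + E.Q p * E.b2 p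

def c21 : PlaneField := fun p => pdy E.b2 p - E.S p * E.b1 p + E.R p * E.b2 p

def d10 : PlaneField := fun p =>
  pdx E.c10 p - 2 * E.Q p * E.c10 p + E.P p * (E.c20 p + E.c11 p) - 5 * E.a0 p * E.b1 p

def d20 : PlaneField := fun p =>
  pdx E.c20 p - E.R p * E.c10 p + E.P p * E.c21 p - 4 * E.a1 p * E.b1 p - E.a0 p * E.b2 p

def d30 : PlaneField := fun p =>
  pdy E.c20 p - E.S p * E.c10 p + E.Q p * E.c21 p - 4 * E.a2 p * E.b1 p - E.a1 p * E.b2 p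

def d11 : PlaneField := fun p =>
  pdx E.c11 p - E.R p * E.c10 p + E.P p * E.c21 p - E.a1 p * E.b1 p - 4 * E.a0 p * E.b2 p

def j0 : PlaneField := fun p =>
  3 / E.b1 p * (E.b2 p / E.b1 p * E.d10 p - E.d11 p)
    + 6 * E.c10 p / E.b1 p ^ 2 * (E.c11 p - E.b2 p / E.b1 p * E.c10 p)

def j1 : PlaneField := fun p =>
  5 / 6 * (2 * E.b2 p * E.d20 p - E.b1 p * E.d30 p - E.b2 p ^ 2 / E.b1 p * E.d10 p)
    + (E.c20 p - 2 / 3 * E.c11 p - E.b2 p / (3 * E.b1 p) * E.c10 p)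
      * (E.c20 p + E.c11 p - 2 * (E.b2 p / E.b1 p) * E.c10 p)

def j2 : PlaneField := fun p =>
  1 / E.b1 p * (E.d20 p - E.b2 p / E.b1 p * E.d10 p)
    + E.c10 p / (5 * E.b1 p ^ 2)
      * (7 * (E.b2 p / E.b1 p) * E.c10 p - 6 * E.c20 p - E.c11 p)

def j3 : PlaneField := fun p =>
  3 / 5 * (E.d10 p / E.b1 p ^ 3 - 6 * E.c10 p ^ 2 / (5 * E.b1 p ^ 4))

def j5 : PlaneField := fun p =>
  5 * (2 * E.j1 p * E.j3 p + (E.j2 p - E.j0 p / 6) ^ 2)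

/-- Bagderina's second basic invariant; it is defined where `b1 ≠ 0` and `j0 ≠ 0`. -/
def I2Bgd : PlaneField := fun p => E.j5 p / E.j0 p ^ 2

/-! ### The two classes of equations -/

/-- The first case of intermediate degeneration on the domain `U`. -/
def ShrID1 (U : Set (ℝ × ℝ)) : Prop :=
  ∀ p ∈ U, E.F p = 0 ∧ (E.A p ≠ 0 ∨ E.B p ≠ 0) ∧ E.M p ≠ 0

/-- Bagderina's equations of type two on the domain `U`. -/
def BgdET2 (U : Set (ℝ × ℝ)) : Prop :=
  ∀ p ∈ U, E.F p = 0 ∧ (E.A p ≠ 0 ∨ E.B p ≠ 0) ∧ E.Om p ≠ 0 ∧ E.N p ≠ 0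

end CubicODE

/-! ### Expressions in the terms of a sequence -/

/-- Formal expressions in variables `X_k`, built from rational constants by the field operations
and square roots. -/
inductive RadExpr : Type
  | const (q : ℚ) : RadExpr
  | var (k : ℕ) : RadExpr
  | add (a b : RadExpr) : RadExpr
  | mul (a b : RadExpr) : RadExpr
  | inv (a : RadExpr) : RadExpr
  | sqrt (a : RadExpr) : RadExpr

/-- `RadExpr.Value v W e g`: on the set `W`, the function `g` is a value of the expression `e` at
`X_k = v k`. Reciprocals are taken only of functions without zeros in `W`; a square root of `f` is
any continuous function on `W` whose square is `f`. -/
def RadExpr.Value (v : ℕ → PlaneField) (W : Set (ℝ × ℝ)) : RadExpr → PlaneField → Prop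
  | .const q, g => ∀ p ∈ W, g p = q
  | .var k, g => ∀ p ∈ W, g p = v k p
  | .add a b, g => ∃ f₁ f₂, RadExpr.Value v W a f₁ ∧ RadExpr.Value v W b f₂ ∧
      ∀ p ∈ W, g p = f₁ p + f₂ p
  | .mul a b, g => ∃ f₁ f₂, RadExpr.Value v W a f₁ ∧ RadExpr.Value v W b f₂ ∧
      ∀ p ∈ W, g p = f₁ p * f₂ p
  | .inv a, g => ∃ f, RadExpr.Value v W a f ∧ ∀ p ∈ W, f p ≠ 0 ∧ g p = (f p)⁻¹
  | .sqrt a, g => ∃ f, RadExpr.Value v W a f ∧ ContinuousOn g W ∧ ∀ p ∈ W, g p ^ 2 = f p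

end

/-! The quantities `φ` define a connection for which `∇_k αⁱ = -(3/5) N δⁱ_k`, and with lower
indices `γ = -∇N - 2Ωα`. Bagderina's quantities are components of one symmetric tensor `Z`, three
times the symmetrized Ricci tensor of this connection: `j0 = -3Ω`, and `j5` is a constant multiple
of `det Z` (`j0_eq`, `j5_eq`). Commuting the derivatives of `α` determines `Z(α, ·)` (`Z_alpha_one`,
`Z_alpha_two`), so in the frame `(α, γ)`, of determinant `M`, only `Z(γ, γ)` remains unknown
(`j5_mul_M`).

`Z(γ, γ)` is a curvature component. Write `∇_α γ = aα + bγ` and `∇_γ γ = cα + dγ`; then `Zgamma_eq`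
expresses it through `a, b, c, d` and the derivatives of `cM` along `α` and of `aM` along `γ`. Here
`b` and `d` come from `∇M`, `a` from commuting the derivatives of `N` (`aM_eq`), and `c` is `Γ¹₂₂`.
Normalizing by weights leaves a rational function of `I₁, …, I₆` and of derivatives along `γ`
(`I2Bgd_eq_bgdFormula`).

The invariants record only squares of derivatives along `γ`. As `Ω² = I₂ N`, the function `Ω ∇_γ I_j
/ N²` is a continuous square root of a product of two invariants (`normalized_sq`). The only second
derivative, `∇_γ ∇_γ I₁`, is recovered from `∇_γ I₇` where `I₇ ≠ 0` (`gamma_I_seven`) and vanishes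
on open sets where `I₇ = 0`; hence two expressions. -/

/-! ### Calculus of partial derivatives -/

/-- Smoothness at a point, as a class so that `simp` finds the side conditions of the rules of
differentiation. -/
class SmoothAt (f : PlaneField) (p : ℝ × ℝ) : Prop where
  contDiffAt : ContDiffAt ℝ (⊤ : ℕ∞) f p

namespace SmoothAt

variable {f g : PlaneField} {p : ℝ × ℝ}

theorem differentiableAt (f : PlaneField) (p : ℝ × ℝ) [h : SmoothAt f p] :
    DifferentiableAt ℝ f p :=
  h.contDiffAt.differentiableAt (by simp)

theorem congr {W : Set (ℝ × ℝ)} (hW : IsOpen W) (hp : p ∈ W) (hg : SmoothAt g p)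
    (h : ∀ q ∈ W, f q = g q) : SmoothAt f p :=
  ⟨hg.contDiffAt.congr_of_eventuallyEq (Filter.eventually_of_mem (hW.mem_nhds hp) h)⟩

instance const (c : ℝ) : SmoothAt (fun _ => c) p := ⟨contDiffAt_const⟩

instance neg [hf : SmoothAt f p] : SmoothAt (fun q => -f q) p :=
  ⟨hf.contDiffAt.neg⟩

instance add [hf : SmoothAt f p] [hg : SmoothAt g p] : SmoothAt (fun q => f q + g q) p :=
  ⟨hf.contDiffAt.add hg.contDiffAt⟩

instance sub [hf : SmoothAt f p] [hg : SmoothAt g p] : SmoothAt (fun q => f q - g q) p :=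
  ⟨hf.contDiffAt.sub hg.contDiffAt⟩

instance mul [hf : SmoothAt f p] [hg : SmoothAt g p] : SmoothAt (fun q => f q * g q) p :=
  ⟨hf.contDiffAt.mul hg.contDiffAt⟩

instance pow (n : ℕ) [hf : SmoothAt f p] : SmoothAt (fun q => f q ^ n) p :=
  ⟨hf.contDiffAt.pow n⟩

/-- Not an instance: instance search cannot supply a nonvanishing denominator. -/
theorem div (hf : SmoothAt f p) (hg : SmoothAt g p) (h : g p ≠ 0) :
    SmoothAt (fun q => f q / g q) p :=
  ⟨hf.contDiffAt.div hg.contDiffAt h⟩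

instance pdx [hf : SmoothAt f p] : SmoothAt (pdx f) p :=
  ⟨(hf.contDiffAt.fderiv_right (m := (⊤ : ℕ∞)) (by simp)).clm_apply contDiffAt_const⟩

instance pdy [hf : SmoothAt f p] : SmoothAt (pdy f) p :=
  ⟨(hf.contDiffAt.fderiv_right (m := (⊤ : ℕ∞)) (by simp)).clm_apply contDiffAt_const⟩

end SmoothAt

section Calculus

variable {f g : PlaneField} {p : ℝ × ℝ} {W : Set (ℝ × ℝ)}

theorem pdx_const (c : ℝ) : pdx (fun _ => c) p = 0 := by simp [pdx]

theorem pdy_const (c : ℝ) : pdy (fun _ => c) p = 0 := by simp [pdy]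

theorem pdx_neg : pdx (fun q => -f q) p = -pdx f p := by simp [pdx]

theorem pdy_neg : pdy (fun q => -f q) p = -pdy f p := by simp [pdy]

theorem pdx_sq [SmoothAt f p] : pdx (fun q => f q ^ 2) p = 2 * f p * pdx f p := by
  simp [pdx, fderiv_fun_pow 2 (SmoothAt.differentiableAt f p)]

theorem pdy_sq [SmoothAt f p] : pdy (fun q => f q ^ 2) p = 2 * f p * pdy f p := by
  simp [pdy, fderiv_fun_pow 2 (SmoothAt.differentiableAt f p)]

theorem pdx_congr (hW : IsOpen W) (hp : p ∈ W) (h : ∀ q ∈ W, f q = g q) :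
    pdx f p = pdx g p := by
  have : f =ᶠ[nhds p] g := Filter.eventually_of_mem (hW.mem_nhds hp) h
  simp only [pdx, this.fderiv_eq]

theorem pdy_congr (hW : IsOpen W) (hp : p ∈ W) (h : ∀ q ∈ W, f q = g q) :
    pdy f p = pdy g p := by
  have : f =ᶠ[nhds p] g := Filter.eventually_of_mem (hW.mem_nhds hp) h
  simp only [pdy, this.fderiv_eq]

/-- Every curvature identity below is this symmetry applied to `A`, `B`, `N`, `γ₁` or `γ₂`. -/
theorem pdx_pdy_comm (f : PlaneField) (p : ℝ × ℝ) [hf : SmoothAt f p] :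
    pdx (pdy f) p = pdy (pdx f) p := by
  have hs : IsSymmSndFDerivAt ℝ f p := hf.contDiffAt.isSymmSndFDerivAt
    (by simpa using (WithTop.coe_le_coe.2 (le_top : (2 : ℕ∞) ≤ ⊤)))
  have hd : DifferentiableAt ℝ (fderiv ℝ f) p :=
    (hf.contDiffAt.fderiv_right (m := (⊤ : ℕ∞)) (by simp)).differentiableAt (by simp)
  have key : ∀ v w : ℝ × ℝ,
      fderiv ℝ (fun q => fderiv ℝ f q v) p w = fderiv ℝ (fderiv ℝ f) p w v := by
    intro v w
    rw [fderiv_clm_apply hd (by fun_prop)]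
    simp
  change fderiv ℝ (fun q => fderiv ℝ f q (0, 1)) p (1, 0)
    = fderiv ℝ (fun q => fderiv ℝ f q (1, 0)) p (0, 1)
  rw [key, key]
  exact hs _ _

variable [SmoothAt f p] [SmoothAt g p]

theorem pdx_add : pdx (fun q => f q + g q) p = pdx f p + pdx g p := by
  simp [pdx, fderiv_fun_add (SmoothAt.differentiableAt f p) (SmoothAt.differentiableAt g p)]

theorem pdy_add : pdy (fun q => f q + g q) p = pdy f p + pdy g p := by
  simp [pdy, fderiv_fun_add (SmoothAt.differentiableAt f p) (SmoothAt.differentiableAt g p)]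

theorem pdx_sub : pdx (fun q => f q - g q) p = pdx f p - pdx g p := by
  simp [pdx, fderiv_fun_sub (SmoothAt.differentiableAt f p) (SmoothAt.differentiableAt g p)]

theorem pdy_sub : pdy (fun q => f q - g q) p = pdy f p - pdy g p := by
  simp [pdy, fderiv_fun_sub (SmoothAt.differentiableAt f p) (SmoothAt.differentiableAt g p)]

theorem pdx_mul : pdx (fun q => f q * g q) p = pdx f p * g p + f p * pdx g p := by
  simp [pdx, fderiv_fun_mul (SmoothAt.differentiableAt f p) (SmoothAt.differentiableAt g p)]
  ring

theorem pdy_mul : pdy (fun q => f q * g q) p = pdy f p * g p + f p * pdy g p := by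
  simp [pdy, fderiv_fun_mul (SmoothAt.differentiableAt f p) (SmoothAt.differentiableAt g p)]
  ring

end Calculus

/-! ### The adapted frame and its structure equations -/

namespace CubicODE

/-- The equation has a smooth adapted frame `(α, γ)` on the open set `W`, where `A ≠ 0`: the fields
are smooth, and `α`, `N` satisfy their structure equations. -/
structure Adapted (E : CubicODE) (W : Set (ℝ × ℝ)) : Prop where
  isOpen : IsOpen W
  smooth_P : ∀ p ∈ W, SmoothAt E.P p
  smooth_Q : ∀ p ∈ W, SmoothAt E.Q p
  smooth_R : ∀ p ∈ W, SmoothAt E.R p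
  smooth_S : ∀ p ∈ W, SmoothAt E.S p
  smooth_A : ∀ p ∈ W, SmoothAt E.A p
  smooth_B : ∀ p ∈ W, SmoothAt E.B p
  smooth_N : ∀ p ∈ W, SmoothAt E.N p
  smooth_phi1 : ∀ p ∈ W, SmoothAt E.phi1 p
  smooth_phi2 : ∀ p ∈ W, SmoothAt E.phi2 p
  smooth_Om : ∀ p ∈ W, SmoothAt E.Om p
  smooth_gamma1 : ∀ p ∈ W, SmoothAt E.gamma1 p
  smooth_gamma2 : ∀ p ∈ W, SmoothAt E.gamma2 p
  A_ne : ∀ p ∈ W, E.A p ≠ 0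
  M_ne : ∀ p ∈ W, E.M p ≠ 0
  N_ne : ∀ p ∈ W, E.N p ≠ 0
  Om_ne : ∀ p ∈ W, E.Om p ≠ 0
  -- Covariantly, the four equations for `A` and `B` say that `∇_k α_i` is skew with entries `±(3/5)
  -- N`, that is, `∇_k αⁱ = -(3/5) N δⁱ_k`.
  A_x : ∀ p ∈ W, pdx E.A p = E.Q p * E.A p - E.P p * E.B p - 5 / 3 * E.A p * E.phi1 p
  A_y : ∀ p ∈ W, pdy E.A p = E.R p * E.A p - E.Q p * E.B p - 1 / 3 * E.B p * E.phi1 p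
    - 4 / 3 * E.A p * E.phi2 p + 3 / 5 * E.N p
  B_x : ∀ p ∈ W, pdx E.B p = E.R p * E.A p - E.Q p * E.B p - 4 / 3 * E.B p * E.phi1 p
    - 1 / 3 * E.A p * E.phi2 p - 3 / 5 * E.N p
  B_y : ∀ p ∈ W, pdy E.B p = E.S p * E.A p - E.R p * E.B p - 5 / 3 * E.B p * E.phi2 p
  N_x : ∀ p ∈ W, pdx E.N p
    = -E.gamma1 p - 2 * E.Om p * E.A p - 2 * E.phi1 p * E.N p
  N_y : ∀ p ∈ W, pdy E.N p
    = -E.gamma2 p - 2 * E.Om p * E.B p - 2 * E.phi2 p * E.N p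
  M_eq : ∀ p ∈ W, E.M p = E.A p * E.gamma2 p - E.B p * E.gamma1 p
  Om_eq : ∀ p ∈ W, E.Om p = 5 / 3 * (pdy E.phi1 p - pdx E.phi2 p)
  b1_eq : ∀ p ∈ W, E.b1 p = E.A p
  b2_eq : ∀ p ∈ W, E.b2 p = E.B p

/-- Three times the symmetrized Ricci tensor of the connection, component `(1, 1)`. -/
noncomputable def Z11 (E : CubicODE) : PlaneField := fun p =>
  pdx E.phi1 p - E.Q p * E.phi1 p + E.P p * E.phi2 p + 1 / 3 * E.phi1 p ^ 2 + 3 * E.a0 p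

/-- Three times the symmetrized Ricci tensor of the connection, component `(1, 2)`. -/
noncomputable def Z12 (E : CubicODE) : PlaneField := fun p =>
  (pdy E.phi1 p + pdx E.phi2 p) / 2 - E.R p * E.phi1 p + E.Q p * E.phi2 p
    + 1 / 3 * E.phi1 p * E.phi2 p + 3 * E.a1 p

/-- Three times the symmetrized Ricci tensor of the connection, component `(2, 2)`. -/
noncomputable def Z22 (E : CubicODE) : PlaneField := fun p =>
  pdy E.phi2 p - E.S p * E.phi1 p + E.R p * E.phi2 p + 1 / 3 * E.phi2 p ^ 2 + 3 * E.a2 p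

namespace Adapted

variable {E : CubicODE} {W : Set (ℝ × ℝ)} {p : ℝ × ℝ}

theorem smoothAt (h : Adapted E W) (hp : p ∈ W) :
    (SmoothAt E.P p ∧ SmoothAt E.Q p ∧ SmoothAt E.R p ∧ SmoothAt E.S p) ∧
      (SmoothAt E.A p ∧ SmoothAt E.B p ∧ SmoothAt E.N p ∧ SmoothAt E.phi1 p ∧
        SmoothAt E.phi2 p) ∧ SmoothAt E.Om p ∧ SmoothAt E.gamma1 p ∧ SmoothAt E.gamma2 p :=
  ⟨⟨h.smooth_P p hp, h.smooth_Q p hp, h.smooth_R p hp, h.smooth_S p hp⟩,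
    ⟨h.smooth_A p hp, h.smooth_B p hp, h.smooth_N p hp, h.smooth_phi1 p hp, h.smooth_phi2 p hp⟩,
    h.smooth_Om p hp, h.smooth_gamma1 p hp, h.smooth_gamma2 p hp⟩

/-- Contraction of the Ricci tensor with `α`, first component. -/
theorem Z_alpha_one (h : Adapted E W) (hp : p ∈ W) :
    E.B p * E.Z11 p - E.A p * E.Z12 p
      = -(9 / 5) * E.gamma1 p - 9 / 10 * E.Om p * E.A p := by
  obtain ⟨⟨_, _, _, _⟩, ⟨_, _, _, _, _⟩, _⟩ := h.smoothAt hp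
  have e1 := pdy_congr h.isOpen hp h.A_x
  have e2 := pdx_congr h.isOpen hp h.A_y
  have e3 := pdx_pdy_comm E.A p
  simp only [pdy_sub, pdy_mul, pdy_const] at e1
  simp only [pdx_add, pdx_sub, pdx_mul, pdx_const] at e2
  rw [e1, e2] at e3
  simp only [h.A_x p hp, h.A_y p hp, h.B_x p hp, h.B_y p hp, h.N_x p hp] at e3
  have e4 := h.Om_eq p hp
  simp only [Z11, Z12, a0, a1]
  -- `Z12` holds only the symmetrized derivative of `φ`; the antisymmetric remainder is a multiple
  -- of `Ω`, removed by `e4`.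
  linear_combination -3 * e3 - 27 / 10 * E.A p * e4

/-- Contraction of the Ricci tensor with `α`, second component. -/
theorem Z_alpha_two (h : Adapted E W) (hp : p ∈ W) :
    E.B p * E.Z12 p - E.A p * E.Z22 p
      = -(9 / 5) * E.gamma2 p - 9 / 10 * E.Om p * E.B p := by
  obtain ⟨⟨_, _, _, _⟩, ⟨_, _, _, _, _⟩, _⟩ := h.smoothAt hp
  have e1 := pdy_congr h.isOpen hp h.B_x
  have e2 := pdx_congr h.isOpen hp h.B_y
  have e3 := pdx_pdy_comm E.B p
  simp only [pdy_sub, pdy_mul, pdy_const] at e1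
  simp only [pdx_sub, pdx_mul, pdx_const] at e2
  rw [e1, e2] at e3
  simp only [h.A_x p hp, h.A_y p hp, h.B_x p hp, h.B_y p hp, h.N_y p hp] at e3
  have e4 := h.Om_eq p hp
  simp only [Z12, Z22, a1, a2]
  linear_combination -3 * e3 - 27 / 10 * E.B p * e4

/-! ### Bagderina's quantities through the Ricci tensor -/

theorem c10_eq (h : Adapted E W) (hp : p ∈ W) :
    E.c10 p = -(5 / 3) * E.A p * E.phi1 p := by
  simp only [c10, pdx_congr h.isOpen hp h.b1_eq, h.b1_eq p hp, h.b2_eq p hp, h.A_x p hp]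
  ring

theorem c20_eq (h : Adapted E W) (hp : p ∈ W) :
    E.c20 p = -(1 / 3) * E.B p * E.phi1 p - 4 / 3 * E.A p * E.phi2 p + 3 / 5 * E.N p := by
  simp only [c20, pdy_congr h.isOpen hp h.b1_eq, h.b1_eq p hp, h.b2_eq p hp, h.A_y p hp]
  ring

theorem c11_eq (h : Adapted E W) (hp : p ∈ W) :
    E.c11 p = -(4 / 3) * E.B p * E.phi1 p - 1 / 3 * E.A p * E.phi2 p - 3 / 5 * E.N p := by
  simp only [c11, pdx_congr h.isOpen hp h.b2_eq, h.b1_eq p hp, h.b2_eq p hp, h.B_x p hp]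
  ring

theorem c21_eq (h : Adapted E W) (hp : p ∈ W) :
    E.c21 p = -(5 / 3) * E.B p * E.phi2 p := by
  simp only [c21, pdy_congr h.isOpen hp h.b2_eq, h.b1_eq p hp, h.b2_eq p hp, h.B_y p hp]
  ring

theorem d10_eq (h : Adapted E W) (hp : p ∈ W) :
    E.d10 p = E.A p * (10 / 3 * E.phi1 p ^ 2 - 5 / 3 * E.Z11 p) := by
  obtain ⟨⟨_, _, _, _⟩, ⟨_, _, _, _, _⟩, _⟩ := h.smoothAt hp
  have e := pdx_congr h.isOpen hp fun q hq => h.c10_eq hq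
  simp only [pdx_mul, pdx_const, h.A_x p hp] at e
  simp only [d10, h.c10_eq hp, h.c20_eq hp, h.c11_eq hp, h.b1_eq p hp, e, Z11]
  ring

/-- Differentiating `c20` brings in `γ₁` through `N`; the contraction of the Ricci tensor with `α`
trades it back for `Z`. The same happens in `d11_eq`, and with `γ₂` in `d30_eq`. -/
theorem d20_eq (h : Adapted E W) (hp : p ∈ W) :
    E.d20 p = -(5 / 3) * E.A p * E.Z12 p - 1 / 2 * E.Om p * E.A p
      + 5 / 9 * E.B p * E.phi1 p ^ 2 + 25 / 9 * E.A p * E.phi1 p * E.phi2 p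
      - E.N p * E.phi1 p := by
  obtain ⟨⟨_, _, _, _⟩, ⟨_, _, _, _, _⟩, _⟩ := h.smoothAt hp
  have e := pdx_congr h.isOpen hp fun q hq => h.c20_eq hq
  simp only [pdx_mul, pdx_const, pdx_add, pdx_sub, h.A_x p hp, h.B_x p hp, h.N_x p hp] at e
  simp only [d20, h.c10_eq hp, h.c21_eq hp, h.b1_eq p hp, h.b2_eq p hp, e]
  have e1 := h.Z_alpha_one hp
  have e2 := h.Om_eq p hp
  simp only [Z11, Z12] at e1 ⊢
  clear e
  linear_combination -1 / 3 * e1 - 2 / 5 * E.A p * e2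

theorem d11_eq (h : Adapted E W) (hp : p ∈ W) :
    E.d11 p = -(5 / 3) * E.B p * E.Z11 p + E.Om p * E.A p
      + 20 / 9 * E.B p * E.phi1 p ^ 2 + 10 / 9 * E.A p * E.phi1 p * E.phi2 p
      + 2 * E.N p * E.phi1 p := by
  obtain ⟨⟨_, _, _, _⟩, ⟨_, _, _, _, _⟩, _⟩ := h.smoothAt hp
  have e := pdx_congr h.isOpen hp fun q hq => h.c11_eq hq
  simp only [pdx_mul, pdx_const, pdx_sub, h.A_x p hp, h.B_x p hp, h.N_x p hp] at e
  simp only [d11, h.c10_eq hp, h.c21_eq hp, h.b1_eq p hp, h.b2_eq p hp, e]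
  have e1 := h.Z_alpha_one hp
  have e2 := h.Om_eq p hp
  simp only [Z11, Z12] at e1 ⊢
  clear e
  linear_combination 1 / 3 * e1 - 1 / 10 * E.A p * e2

theorem d30_eq (h : Adapted E W) (hp : p ∈ W) :
    E.d30 p = -(5 / 3) * E.A p * E.Z22 p - E.Om p * E.B p
      + 10 / 9 * E.B p * E.phi1 p * E.phi2 p + 20 / 9 * E.A p * E.phi2 p ^ 2
      - 2 * E.N p * E.phi2 p := by
  obtain ⟨⟨_, _, _, _⟩, ⟨_, _, _, _, _⟩, _⟩ := h.smoothAt hp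
  have e := pdy_congr h.isOpen hp fun q hq => h.c20_eq hq
  simp only [pdy_mul, pdy_const, pdy_add, pdy_sub, h.A_y p hp, h.B_y p hp, h.N_y p hp] at e
  simp only [d30, h.c10_eq hp, h.c21_eq hp, h.b1_eq p hp, h.b2_eq p hp, e]
  have e1 := h.Z_alpha_two hp
  have e2 := h.Om_eq p hp
  simp only [Z12, Z22] at e1 ⊢
  clear e
  linear_combination -1 / 3 * e1 + 1 / 10 * E.B p * e2

/-- The terms in `Z11`, `φ` and `N` cancel between `d10`, `d11` and the `c`-products, leaving the
skew part of the derivative of `φ`. -/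
theorem j0_eq (h : Adapted E W) (hp : p ∈ W) : E.j0 p = -3 * E.Om p := by
  have hA := h.A_ne p hp
  simp only [j0, h.d10_eq hp, h.d11_eq hp, h.c10_eq hp, h.c11_eq hp, h.b1_eq p hp, h.b2_eq p hp]
  field_simp
  ring

/-- Up to factors, and up to a term in `Ω` in `j2`, the quantities `j1`, `j2`, `j3` are `Z(α, α)`,
`Z(α, ∂ₓ)`, `Z(∂ₓ, ∂ₓ)`. -/
theorem j1_eq (h : Adapted E W) (hp : p ∈ W) :
    E.j1 p = 25 / 18 * (E.A p ^ 2 * E.Z22 p - 2 * E.A p * E.B p * E.Z12 p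
      + E.B p ^ 2 * E.Z11 p) := by
  have hA := h.A_ne p hp
  simp only [j1, h.d10_eq hp, h.d20_eq hp, h.d30_eq hp, h.c10_eq hp, h.c11_eq hp, h.c20_eq hp,
    h.b1_eq p hp, h.b2_eq p hp]
  field_simp
  ring

theorem j2_eq (h : Adapted E W) (hp : p ∈ W) :
    E.j2 p = 5 / 3 * (E.B p * E.Z11 p - E.A p * E.Z12 p) / E.A p - 1 / 2 * E.Om p := by
  have hA := h.A_ne p hp
  simp only [j2, h.d10_eq hp, h.d20_eq hp, h.c10_eq hp, h.c11_eq hp, h.c20_eq hp,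
    h.b1_eq p hp, h.b2_eq p hp]
  field_simp
  ring

theorem j3_eq (h : Adapted E W) (hp : p ∈ W) : E.j3 p = -E.Z11 p / E.A p ^ 2 := by
  have hA := h.A_ne p hp
  simp only [j3, h.d10_eq hp, h.c10_eq hp, h.b1_eq p hp]
  field_simp
  ring

/-- Up to a constant factor, `j₅` is the determinant of the symmetrized Ricci tensor. -/
theorem j5_eq (h : Adapted E W) (hp : p ∈ W) :
    E.j5 p = 125 / 9 * (E.Z12 p ^ 2 - E.Z11 p * E.Z22 p) := by
  have hA := h.A_ne p hp
  -- The shift by `j0 / 6` removes exactly the `Ω` term of `j2`. What remains is the determinant of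
  -- `Z` in the basis `(α, ∂ₓ)`, whose own determinant is `A`.
  simp only [j5, h.j0_eq hp, h.j1_eq hp, h.j2_eq hp, h.j3_eq hp]
  field_simp
  ring

/-- The component of the Ricci tensor in the direction of `γ`, up to the factor of `Z11`. -/
noncomputable def _root_.CubicODE.Zgamma (E : CubicODE) : PlaneField := fun p =>
  E.gamma2 p ^ 2 * E.Z11 p - 2 * E.gamma1 p * E.gamma2 p * E.Z12 p + E.gamma1 p ^ 2 * E.Z22 p

/-- The determinant of `Z` is now computed in the frame `(α, γ)`, where it acquires the factor `M²`.
The contractions with `α` give `Z(α, α) = (9/5) M` and `Z(α, γ) = -(9/10) Ω M`. -/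
theorem j5_mul_M (h : Adapted E W) (hp : p ∈ W) :
    E.j5 p * E.M p = 45 / 4 * E.Om p ^ 2 * E.M p - 25 * E.Zgamma p := by
  have hM := h.M_ne p hp
  have e1 := h.Z_alpha_one hp
  have e2 := h.Z_alpha_two hp
  rw [h.j5_eq hp]
  rw [h.M_eq p hp] at hM ⊢
  apply mul_right_cancel₀ hM
  simp only [Zgamma]
  linear_combination 125 / 9 * (E.gamma2 p * (E.B p * E.Z11 p - E.A p * E.Z12 p)
      - E.gamma1 p * (E.B p * E.Z12 p - E.A p * E.Z22 p)
      - 9 / 10 * E.Om p * (E.A p * E.gamma2 p - E.B p * E.gamma1 p))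
      * (E.gamma2 p * e1 - E.gamma1 p * e2)
    - 125 / 9 * (E.gamma2 p ^ 2 * E.Z11 p - 2 * E.gamma1 p * E.gamma2 p * E.Z12 p
      + E.gamma1 p ^ 2 * E.Z22 p) * (E.B p * e1 - E.A p * e2)

theorem I2Bgd_eq (h : Adapted E W) (hp : p ∈ W) :
    E.I2Bgd p = 5 / 4 - 25 / 9 * (E.Zgamma p / (E.M p * E.Om p ^ 2)) := by
  have hM := h.M_ne p hp
  have hO := h.Om_ne p hp
  have e := h.j5_mul_M hp
  simp only [I2Bgd, h.j0_eq hp]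
  field_simp
  linear_combination 36 * e

end Adapted
-- Covariant derivatives of `γ` and the curvature in the frame
variable (E : CubicODE)

theorem covScalarAlong_alphaUp (m : ℝ) (f : PlaneField) (p : ℝ × ℝ) :
    E.covScalarAlong m E.alphaUp f p
      = E.B p * (pdx f p + m * E.phi1 p * f p) - E.A p * (pdy f p + m * E.phi2 p * f p) := by
  simp [covScalarAlong, covScalar, alphaUp, alphaDown, dMat, pd, phi, Fin.sum_univ_two]
  ring

theorem covScalarAlong_gammaUp (m : ℝ) (f : PlaneField) (p : ℝ × ℝ) :
    E.covScalarAlong m E.gammaUp f p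
      = E.gamma2 p * (pdx f p + m * E.phi1 p * f p)
        - E.gamma1 p * (pdy f p + m * E.phi2 p * f p) := by
  simp [covScalarAlong, covScalar, gammaUp, gammaDown, dMat, pd, phi, Fin.sum_univ_two]
  ring

/-- The covariant derivative `∇₁γ₁`. -/
noncomputable def T11 : PlaneField := fun p =>
  pdx E.gamma1 p - (E.Q p * E.gamma1 p - E.P p * E.gamma2 p) + 8 / 3 * E.phi1 p * E.gamma1 p

/-- The covariant derivative `∇₂γ₁`. -/
noncomputable def T12 : PlaneField := fun p =>
  pdy E.gamma1 p - (E.R p * E.gamma1 p - E.Q p * E.gamma2 p)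
    + 1 / 3 * E.phi1 p * E.gamma2 p + 7 / 3 * E.phi2 p * E.gamma1 p

/-- The covariant derivative `∇₁γ₂`. -/
noncomputable def T21 : PlaneField := fun p =>
  pdx E.gamma2 p - (E.R p * E.gamma1 p - E.Q p * E.gamma2 p)
    + 7 / 3 * E.phi1 p * E.gamma2 p + 1 / 3 * E.phi2 p * E.gamma1 p

/-- The covariant derivative `∇₂γ₂`. -/
noncomputable def T22 : PlaneField := fun p =>
  pdy E.gamma2 p - (E.S p * E.gamma1 p - E.R p * E.gamma2 p) + 8 / 3 * E.phi2 p * E.gamma2 p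

/-- The product `a M`, where `∇_α γ = a α + b γ`. -/
noncomputable def aM : PlaneField := fun p =>
  E.gamma2 p * (E.B p * E.T11 p - E.A p * E.T12 p)
    - E.gamma1 p * (E.B p * E.T21 p - E.A p * E.T22 p)

/-- The product `b M`, where `∇_α γ = a α + b γ`. -/
noncomputable def bM : PlaneField := fun p =>
  E.A p * (E.B p * E.T21 p - E.A p * E.T22 p) - E.B p * (E.B p * E.T11 p - E.A p * E.T12 p)

/-- The product `c M`, where `∇_γ γ = c α + d γ`. -/
noncomputable def cM : PlaneField := fun p =>
  E.gamma2 p * (E.gamma2 p * E.T11 p - E.gamma1 p * E.T12 p)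
    - E.gamma1 p * (E.gamma2 p * E.T21 p - E.gamma1 p * E.T22 p)

/-- The product `d M`, where `∇_γ γ = c α + d γ`. -/
noncomputable def dM : PlaneField := fun p =>
  E.A p * (E.gamma2 p * E.T21 p - E.gamma1 p * E.T22 p)
    - E.B p * (E.gamma2 p * E.T11 p - E.gamma1 p * E.T12 p)

theorem Gamma122_eq (p : ℝ × ℝ) :
    E.Gamma122 p = E.cM p / (E.A p * E.gamma2 p - E.B p * E.gamma1 p) := by
  have d00 : dMat 0 0 = 0 := by simp [dMat]
  have d01 : dMat 0 1 = 1 := by simp [dMat]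
  have d10 : dMat 1 0 = -1 := by simp [dMat]
  have d11 : dMat 1 1 = 0 := by simp [dMat]
  have h0 : E.gammaUp 0 = E.gamma2 := by
    funext q; simp [gammaUp, gammaDown, dMat, Fin.sum_univ_two]
  have h1 : E.gammaUp 1 = fun q => -E.gamma1 q := by
    funext q; simp [gammaUp, gammaDown, dMat, Fin.sum_univ_two]
  have h2 : E.alphaUp 0 = E.B := by
    funext q; simp [alphaUp, alphaDown, dMat, Fin.sum_univ_two]
  have h3 : E.alphaUp 1 = fun q => -E.A q := by
    funext q; simp [alphaUp, alphaDown, dMat, Fin.sum_univ_two]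
  simp only [Gamma122, h2, h3, covVectorAlong, covVector, conn, theta, Theta, Fin.sum_univ_two, h0,
    h1, pd, phi, d00, d01, d10, d11, cM, T11, T12, T21, T22, pdx_neg, pdy_neg, Fin.isValue,
    Fin.val_zero, Fin.val_one, one_ne_zero, if_true, if_false, zero_ne_one, pdx_neg, pdy_neg]
  congr 1 <;> ring

namespace Adapted

variable {E : CubicODE} {W : Set (ℝ × ℝ)} {p : ℝ × ℝ}

theorem smooth_T (h : Adapted E W) (hp : p ∈ W) :
    SmoothAt E.T11 p ∧ SmoothAt E.T12 p ∧ SmoothAt E.T21 p ∧ SmoothAt E.T22 p := by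
  obtain ⟨⟨_, _, _, _⟩, ⟨_, _, _, _, _⟩, _, _, _⟩ := h.smoothAt hp
  refine ⟨?_, ?_, ?_, ?_⟩ <;> [unfold T11; unfold T12; unfold T21; unfold T22] <;> infer_instance

/-- As rewrite rules, this and its three companions replace partial derivatives of `γ` by covariant
ones, so that tensorial identities become polynomial identities in the `T`'s. -/
theorem gamma1_x (E : CubicODE) (p : ℝ × ℝ) : pdx E.gamma1 p = E.T11 p
    + E.Q p * E.gamma1 p - E.P p * E.gamma2 p - 8 / 3 * E.phi1 p * E.gamma1 p := by
  simp only [T11]; ring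

theorem gamma1_y (E : CubicODE) (p : ℝ × ℝ) : pdy E.gamma1 p = E.T12 p
    + E.R p * E.gamma1 p - E.Q p * E.gamma2 p
    - 1 / 3 * E.phi1 p * E.gamma2 p - 7 / 3 * E.phi2 p * E.gamma1 p := by
  simp only [T12]; ring

theorem gamma2_x (E : CubicODE) (p : ℝ × ℝ) : pdx E.gamma2 p = E.T21 p
    + E.R p * E.gamma1 p - E.Q p * E.gamma2 p
    - 7 / 3 * E.phi1 p * E.gamma2 p - 1 / 3 * E.phi2 p * E.gamma1 p := by
  simp only [T21]; ring

theorem gamma2_y (E : CubicODE) (p : ℝ × ℝ) : pdy E.gamma2 p = E.T22 p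
    + E.S p * E.gamma1 p - E.R p * E.gamma2 p - 8 / 3 * E.phi2 p * E.gamma2 p := by
  simp only [T22]; ring

/-- The Ricci identity for `γ`, contracted with `γ`. -/
theorem ricci_gamma (h : Adapted E W) (hp : p ∈ W) :
    E.gamma2 p * (pdx E.T12 p - pdy E.T11 p)
      - E.gamma1 p * (pdx E.T22 p - pdy E.T21 p)
      - E.gamma2 p * (E.Q p * (E.T12 p + E.T21 p) - E.R p * E.T11 p - E.P p * E.T22 p)
      + E.gamma1 p * (E.R p * (E.T12 p + E.T21 p) - E.Q p * E.T22 p - E.S p * E.T11 p)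
      - E.gamma2 p * (1 / 3 * E.phi1 p * E.T21 p - 8 / 3 * E.phi1 p * E.T12 p
        + 7 / 3 * E.phi2 p * E.T11 p)
      + E.gamma1 p * (8 / 3 * E.phi2 p * E.T21 p - 1 / 3 * E.phi2 p * E.T12 p
        - 7 / 3 * E.phi1 p * E.T22 p) = 1 / 3 * E.Zgamma p := by
  obtain ⟨⟨_, _, _, _⟩, ⟨_, _, _, _, _⟩, _, _, _⟩ := h.smoothAt hp
  obtain ⟨_, _, _, _⟩ := h.smooth_T hp
  have e1 := pdx_pdy_comm E.gamma1 p
  have e2 := pdx_pdy_comm E.gamma2 p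
  rw [funext (gamma1_x E), funext (gamma1_y E)] at e1
  rw [funext (gamma2_x E), funext (gamma2_y E)] at e2
  simp only [pdx_add, pdx_sub, pdx_mul, pdx_const, pdy_add, pdy_sub, pdy_mul, pdy_const, gamma1_x,
    gamma1_y, gamma2_x, gamma2_y] at e1 e2
  simp only [Zgamma, Z11, Z12, Z22, a0, a1, a2]
  linear_combination E.gamma2 p * e1 - E.gamma1 p * e2

theorem smooth_cM (h : Adapted E W) (hp : p ∈ W) : SmoothAt E.cM p := by
  obtain ⟨⟨_, _, _, _⟩, ⟨_, _, _, _, _⟩, _, _, _⟩ := h.smoothAt hp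
  obtain ⟨_, _, _, _⟩ := h.smooth_T hp
  unfold cM; infer_instance

theorem smooth_aM (h : Adapted E W) (hp : p ∈ W) : SmoothAt E.aM p := by
  obtain ⟨⟨_, _, _, _⟩, ⟨_, _, _, _, _⟩, _, _, _⟩ := h.smoothAt hp
  obtain ⟨_, _, _, _⟩ := h.smooth_T hp
  unfold aM; infer_instance

/-- The curvature of the connection in the frame `(α, γ)`. -/
theorem Zgamma_eq (h : Adapted E W) (hp : p ∈ W) :
    1 / 3 * E.Zgamma p * E.M p ^ 2 =
      E.M p * (E.covScalarAlong 8 E.alphaUp E.cM p - E.covScalarAlong 7 E.gammaUp E.aM p)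
        + 2 * E.dM p * E.aM p - E.aM p ^ 2 - 3 * E.bM p * E.cM p
        - 3 / 5 * E.N p * E.M p * E.cM p := by
  obtain ⟨⟨_, _, _, _⟩, ⟨_, _, _, _, _⟩, _, _, _⟩ := h.smoothAt hp
  obtain ⟨_, _, _, _⟩ := h.smooth_T hp
  have e := h.ricci_gamma hp
  have c : E.cM = fun q => E.gamma2 q * (E.gamma2 q * E.T11 q - E.gamma1 q * E.T12 q)
    - E.gamma1 q * (E.gamma2 q * E.T21 q - E.gamma1 q * E.T22 q) := rfl
  have a : E.aM = fun q => E.gamma2 q * (E.B q * E.T11 q - E.A q * E.T12 q)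
    - E.gamma1 q * (E.B q * E.T21 q - E.A q * E.T22 q) := rfl
  rw [covScalarAlong_alphaUp, covScalarAlong_gammaUp, c, a, h.M_eq p hp]
  simp only [pdx_sub, pdx_mul, pdy_sub, pdy_mul, gamma1_x, gamma1_y, gamma2_x, gamma2_y,
    h.A_x p hp, h.A_y p hp, h.B_x p hp, h.B_y p hp, bM, dM]
  -- In the difference of the two derivatives the `T`'s are differentiated only through their curl
  -- contracted with `γ`, times `M`; the outer factor supplies the second `M`.
  linear_combination -(E.A p * E.gamma2 p - E.B p * E.gamma1 p) ^ 2 * e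

end Adapted
-- Leibniz rule with weights, and the invariants that are needed
section Leibniz

variable (E : CubicODE) {f g : PlaneField} {p : ℝ × ℝ} {W : Set (ℝ × ℝ)} (m n : ℝ)
  (Z : Fin 2 → PlaneField)

theorem covScalarAlong_congr (hW : IsOpen W) (hp : p ∈ W) (h : ∀ q ∈ W, f q = g q) :
    E.covScalarAlong m Z f p = E.covScalarAlong m Z g p := by
  simp only [covScalarAlong, covScalar, Fin.sum_univ_two, pd, if_true, Fin.isValue, one_ne_zero,
    if_false, pdx_congr hW hp h, pdy_congr hW hp h, h p hp]

variable [SmoothAt f p] [SmoothAt g p]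

theorem covScalarAlong_mul : E.covScalarAlong (m + n) Z (fun q => f q * g q) p
    = E.covScalarAlong m Z f p * g p + f p * E.covScalarAlong n Z g p := by
  simp only [covScalarAlong, covScalar, Fin.sum_univ_two, pd, if_true, Fin.isValue, one_ne_zero,
    if_false, pdx_mul, pdy_mul]
  ring

theorem covScalarAlong_add : E.covScalarAlong m Z (fun q => f q + g q) p
    = E.covScalarAlong m Z f p + E.covScalarAlong m Z g p := by
  simp only [covScalarAlong, covScalar, Fin.sum_univ_two, pd, if_true, Fin.isValue, one_ne_zero,
    if_false, pdx_add, pdy_add]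
  ring

theorem covScalarAlong_sub : E.covScalarAlong m Z (fun q => f q - g q) p
    = E.covScalarAlong m Z f p - E.covScalarAlong m Z g p := by
  simp only [covScalarAlong, covScalar, Fin.sum_univ_two, pd, if_true, Fin.isValue, one_ne_zero,
    if_false, pdx_sub, pdy_sub]
  ring

theorem covScalarAlong_const_mul (c : ℝ) :
    E.covScalarAlong m Z (fun q => c * f q) p = c * E.covScalarAlong m Z f p := by
  simp only [covScalarAlong, covScalar, Fin.sum_univ_two, pd, if_true, Fin.isValue, one_ne_zero,
    if_false, pdx_mul, pdy_mul, pdx_const, pdy_const]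
  ring

end Leibniz

theorem I_one (E : CubicODE) : E.I 1 = fun p => E.M p / E.N p ^ 2 := by
  simp [I, triple, basicTriple, Fin.ofNat]

theorem I_two (E : CubicODE) : E.I 2 = fun p => E.Om p ^ 2 / E.N p := by
  simp [I, triple, basicTriple, Fin.ofNat]

theorem I_three (E : CubicODE) : E.I 3 = fun p => E.Gamma122 p * E.N p ^ 2 / E.M p ^ 2 := by
  simp [I, triple, basicTriple, Fin.ofNat]

theorem I_four (E : CubicODE) : E.I 4 = E.stepAlpha (E.I 1) := by
  simp [I, triple, Fin.ofNat]

theorem I_five (E : CubicODE) : E.I 5 = E.stepAlpha (E.I 2) := by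
  simp [I, triple, Fin.ofNat]

theorem I_six (E : CubicODE) : E.I 6 = E.stepAlpha (E.I 3) := by
  simp [I, triple, Fin.ofNat]

theorem I_seven (E : CubicODE) : E.I 7 = E.stepGamma (E.I 1) := by
  simp [I, triple, Fin.ofNat]

theorem I_eight (E : CubicODE) : E.I 8 = E.stepGamma (E.I 2) := by
  simp [I, triple, Fin.ofNat]

theorem I_fourteen (E : CubicODE) : E.I 14 = E.stepGamma (E.I 5) := by
  simp [I, triple, Fin.ofNat]

theorem I_nineteen (E : CubicODE) : E.I 19 = E.stepGamma (E.I 7) := by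
  simp [I, triple, Fin.ofNat]

/-! ### Derivatives of `N` and `M` along the frame -/

namespace Adapted

variable {E : CubicODE} {W : Set (ℝ × ℝ)} {p : ℝ × ℝ}

/-- Contract `∇N = -γ - 2Ωα` with the frame: `α` and `γ` each annihilate themselves and pair with
one another to `±M`. The same gives `gamma_N`. -/
theorem alpha_N (h : Adapted E W) (hp : p ∈ W) :
    E.covScalarAlong 2 E.alphaUp E.N p = E.M p := by
  rw [covScalarAlong_alphaUp, h.N_x p hp, h.N_y p hp, h.M_eq p hp]
  ring

theorem gamma_N (h : Adapted E W) (hp : p ∈ W) :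
    E.covScalarAlong 2 E.gammaUp E.N p = -2 * E.Om p * E.M p := by
  rw [covScalarAlong_gammaUp, h.N_x p hp, h.N_y p hp, h.M_eq p hp]
  ring

/-- `M` is the skew product of `α` and `γ`, and `∇_α α = -(3/5) N α`, so only `b` is new. Along `γ`,
in `gamma_M`, the derivative of `α` is proportional to `γ` and drops out. -/
theorem alpha_M (h : Adapted E W) (hp : p ∈ W) :
    E.covScalarAlong 4 E.alphaUp E.M p = E.bM p - 3 / 5 * E.N p * E.M p := by
  obtain ⟨⟨_, _, _, _⟩, ⟨_, _, _, _, _⟩, _, _, _⟩ := h.smoothAt hp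
  rw [E.covScalarAlong_congr _ _ h.isOpen hp h.M_eq, h.M_eq p hp, covScalarAlong_alphaUp]
  simp only [pdx_sub, pdx_mul, pdy_sub, pdy_mul, gamma1_x, gamma1_y, gamma2_x, gamma2_y,
    h.A_x p hp, h.A_y p hp, h.B_x p hp, h.B_y p hp, bM]
  ring

theorem gamma_M (h : Adapted E W) (hp : p ∈ W) :
    E.covScalarAlong 4 E.gammaUp E.M p = E.dM p := by
  obtain ⟨⟨_, _, _, _⟩, ⟨_, _, _, _, _⟩, _, _, _⟩ := h.smoothAt hp
  rw [E.covScalarAlong_congr _ _ h.isOpen hp h.M_eq, covScalarAlong_gammaUp]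
  simp only [pdx_sub, pdx_mul, pdy_sub, pdy_mul, gamma1_x, gamma1_y, gamma2_x, gamma2_y,
    h.A_x p hp, h.A_y p hp, h.B_x p hp, h.B_y p hp, dM]
  ring

/-- The commutator of the frame. -/
theorem aM_eq (h : Adapted E W) (hp : p ∈ W) :
    E.aM p = -E.covScalarAlong 4 E.gammaUp E.M p
      - 2 * E.covScalarAlong 1 E.alphaUp E.Om p * E.M p + 18 / 5 * E.N p * E.Om p * E.M p := by
  obtain ⟨⟨_, _, _, _⟩, ⟨_, _, _, _, _⟩, _, _, _⟩ := h.smoothAt hp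
  have e1 := pdy_congr h.isOpen hp h.N_x
  have e2 := pdx_congr h.isOpen hp h.N_y
  have e3 := pdx_pdy_comm E.N p
  simp only [pdx_sub, pdx_mul, pdx_const, pdx_neg, pdy_sub, pdy_mul, pdy_const, pdy_neg,
    gamma1_y, gamma2_x, h.A_y p hp, h.B_x p hp, h.N_x p hp, h.N_y p hp] at e1 e2
  -- Since `N` has weight `2`, commuting its derivatives leaves `2 N (∂φ₁/∂y - ∂φ₂/∂x) = (6/5) N Ω`.
  have e4 := h.Om_eq p hp
  rw [e1, e2] at e3
  rw [h.gamma_M hp, covScalarAlong_alphaUp, h.M_eq p hp]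
  simp only [dM, aM]
  linear_combination -(E.A p * E.gamma2 p - E.B p * E.gamma1 p) * e3
    - 6 / 5 * E.N p * (E.A p * E.gamma2 p - E.B p * E.gamma1 p) * e4

theorem Gamma122_mul_M (h : Adapted E W) (hp : p ∈ W) : E.Gamma122 p * E.M p = E.cM p := by
  have hM := h.M_ne p hp
  rw [Gamma122_eq, ← h.M_eq p hp, div_mul_cancel₀ _ hM]

end Adapted
-- The universal formula
/-- The formula for `I₂ᴮᵍᵈ` in terms of `I₁, …, I₆`, of the normalized derivatives
`s = Ω ∇_γ I₁ / N²`, `s₂ = Ω ∇_γ I₂ / N²`, `s₅ = Ω ∇_γ I₅ / N²`, and of `t = ∇_γ ∇_γ I₁ / N³`. -/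
noncomputable def bgdFormula (v w u i4 i5 i6 s s2 s5 t : ℝ) : ℝ :=
  let r := 3 * v * w - i5 + 18 / 5 * w
  let d := s / v - 4 * v * w
  let a := r - s / v
  5 / 4 - 25 / 3 * (i6 * v ^ 2 + 2 * u * v * i4 + 2 * u * v ^ 3
    - (2 * (i4 + 2 * v ^ 2) + 12 / 5 * v) * u * v
    + (d * a - a ^ 2 - (3 * s * w + 3 * v * s2 - s5 + 18 / 5 * s2) + 3 * r * v * w) / w
    + r * s2 / (2 * w ^ 2) + t / v - s ^ 2 / (w * v ^ 2)) / (v * w)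

/-- Pure elimination: `X` and `Y` prefixes stand for derivatives along `α` and `γ`. Each unknown is
solved for in turn; `M = v N²` and `N = Ω² / w` then avoid any choice of root, and both sides have
weight zero. -/
theorem bgdFormula_eq {N Om M Y1 Y2 Y5 YY1 XM bM dM cM XcM aM YaM Z v w u i4 i5 i6 YOm : ℝ}
    (hN : N ≠ 0) (hOm : Om ≠ 0) (hM : M ≠ 0)
    (e1 : M = v * N ^ 2) (e2 : Om ^ 2 = w * N)
    (eXM : XM = i4 * N ^ 3 + 2 * v * N * M)
    (ebM : XM = bM - 3 / 5 * N * M)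
    (edM : dM = Y1 * N ^ 2 - 4 * v * N * Om * M)
    (ecM : cM * N ^ 2 = u * M ^ 3)
    (eXcM : XcM * N ^ 2 + 2 * cM * N * M = i6 * N * M ^ 3 + 3 * u * M ^ 2 * XM)
    (eaM : aM * Om = N ^ 2 * (M * (3 * v * w - i5 + 18 / 5 * w) - Om * Y1))
    (eYOm : 2 * Om * YOm = Y2 * N - 2 * w * Om * M)
    (eYaM : YaM * Om + aM * YOm
      = -4 * N * Om * M * (M * (3 * v * w - i5 + 18 / 5 * w) - Om * Y1)
        + N ^ 2 * (dM * (3 * v * w - i5 + 18 / 5 * w)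
          + M * (3 * (Y1 * w + v * Y2) - Y5 + 18 / 5 * Y2) - YOm * Y1 - Om * YY1))
    (eZ : 1 / 3 * Z * M ^ 2 = M * (XcM - YaM) + 2 * dM * aM - aM ^ 2 - 3 * bM * cM
      - 3 / 5 * N * M * cM) :
    5 / 4 - 25 / 9 * (Z / (M * Om ^ 2)) =
      bgdFormula v w u i4 i5 i6 (Om * Y1 / N ^ 2) (Om * Y2 / N ^ 2) (Om * Y5 / N ^ 2)
        (YY1 / N ^ 3) := by
  have hw : w ≠ 0 := by
    rintro rfl
    simp [hOm] at e2
  have hv : v ≠ 0 := by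
    rintro rfl
    simp [hM] at e1
  have eN : N = Om ^ 2 / w := by field_simp; linear_combination -e2
  have hbM : bM = XM + 3 / 5 * N * M := by linear_combination -ebM
  have hcM : cM = u * M ^ 3 / N ^ 2 := by field_simp; linear_combination ecM
  have hXcM : XcM = (i6 * N * M ^ 3 + 3 * u * M ^ 2 * XM - 2 * cM * N * M) / N ^ 2 := by
    field_simp; linear_combination eXcM
  have haM : aM = N ^ 2 * (M * (3 * v * w - i5 + 18 / 5 * w) - Om * Y1) / Om :=
    (eq_div_iff hOm).2 eaM
  have hYOm : YOm = (Y2 * N - 2 * w * Om * M) / (2 * Om) := by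
    field_simp; linear_combination eYOm
  have hYaM : YaM = (-4 * N * Om * M * (M * (3 * v * w - i5 + 18 / 5 * w) - Om * Y1)
        + N ^ 2 * (dM * (3 * v * w - i5 + 18 / 5 * w)
          + M * (3 * (Y1 * w + v * Y2) - Y5 + 18 / 5 * Y2) - YOm * Y1 - Om * YY1)
        - aM * YOm) / Om :=
    (eq_div_iff hOm).2 (by linear_combination eYaM)
  have hZ : Z = 3 * (M * (XcM - YaM) + 2 * dM * aM - aM ^ 2 - 3 * bM * cM
      - 3 / 5 * N * M * cM) / M ^ 2 :=
    (eq_div_iff (pow_ne_zero 2 hM)).2 (by linear_combination 3 * eZ)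
  rw [hZ, hYaM, hXcM, hbM, hcM, eXM, hYOm, edM, haM, e1]
  unfold bgdFormula
  rw [eN]
  field_simp
  ring

instance (E : CubicODE) (m : ℝ) (f : PlaneField) (p : ℝ × ℝ) [SmoothAt f p] [SmoothAt E.A p]
    [SmoothAt E.B p] [SmoothAt E.phi1 p] [SmoothAt E.phi2 p] :
    SmoothAt (E.covScalarAlong m E.alphaUp f) p := by
  rw [funext (E.covScalarAlong_alphaUp m f)]
  infer_instance

instance (E : CubicODE) (m : ℝ) (f : PlaneField) (p : ℝ × ℝ) [SmoothAt f p]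
    [SmoothAt E.gamma1 p] [SmoothAt E.gamma2 p] [SmoothAt E.phi1 p] [SmoothAt E.phi2 p] :
    SmoothAt (E.covScalarAlong m E.gammaUp f) p := by
  rw [funext (E.covScalarAlong_gammaUp m f)]
  infer_instance

namespace Adapted

variable {E : CubicODE} {W : Set (ℝ × ℝ)} {p : ℝ × ℝ}

theorem smooth_M (h : Adapted E W) (hp : p ∈ W) : SmoothAt E.M p := by
  obtain ⟨⟨_, _, _, _⟩, ⟨_, _, _, _, _⟩, _, _, _⟩ := h.smoothAt hp
  exact SmoothAt.congr h.isOpen hp inferInstance h.M_eq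

theorem smooth_Gamma122 (h : Adapted E W) (hp : p ∈ W) : SmoothAt E.Gamma122 p := by
  have hc := h.smooth_cM hp
  have hM := h.smooth_M hp
  exact SmoothAt.congr h.isOpen hp (hc.div hM (h.M_ne p hp)) fun q hq =>
    (eq_div_iff (h.M_ne q hq)).2 (h.Gamma122_mul_M hq)

theorem smooth_stepAlpha (h : Adapted E W) (hp : p ∈ W) {f : PlaneField} (hf : SmoothAt f p) :
    SmoothAt (E.stepAlpha f) p := by
  obtain ⟨⟨_, _, _, _⟩, ⟨_, _, _, _, _⟩, _, _, _⟩ := h.smoothAt hp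
  exact SmoothAt.div inferInstance ‹_› (h.N_ne p hp)

theorem smooth_stepGamma (h : Adapted E W) (hp : p ∈ W) {f : PlaneField} (hf : SmoothAt f p) :
    SmoothAt (E.stepGamma f) p := by
  obtain ⟨⟨_, _, _, _⟩, ⟨_, _, _, _, _⟩, _, _, _⟩ := h.smoothAt hp
  exact SmoothAt.div inferInstance inferInstance (pow_ne_zero 3 (h.N_ne p hp))

theorem smooth_I (h : Adapted E W) (hp : p ∈ W) :
    (SmoothAt (E.I 1) p ∧ SmoothAt (E.I 2) p ∧ SmoothAt (E.I 3) p) ∧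
      SmoothAt (E.I 5) p ∧ SmoothAt (E.I 7) p := by
  obtain ⟨⟨_, _, _, _⟩, ⟨_, _, _, _, _⟩, _, _, _⟩ := h.smoothAt hp
  have hM := h.smooth_M hp
  have hG := h.smooth_Gamma122 hp
  have h1 : SmoothAt (E.I 1) p := by
    rw [I_one]; exact SmoothAt.div ‹_› inferInstance (pow_ne_zero 2 (h.N_ne p hp))
  have h2 : SmoothAt (E.I 2) p := by
    rw [I_two]; exact SmoothAt.div inferInstance ‹_› (h.N_ne p hp)
  have h3 : SmoothAt (E.I 3) p := by
    rw [I_three]; exact SmoothAt.div inferInstance inferInstance (pow_ne_zero 2 (h.M_ne p hp))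
  exact ⟨⟨h1, h2, h3⟩, I_five E ▸ h.smooth_stepAlpha hp h2, I_seven E ▸ h.smooth_stepGamma hp h1⟩

theorem alpha_eq_stepAlpha (h : Adapted E W) (hp : p ∈ W) (f : PlaneField) :
    E.covScalarAlong 0 E.alphaUp f p = E.stepAlpha f p * E.N p := by
  rw [stepAlpha, div_mul_cancel₀ _ (h.N_ne p hp)]

/-- This and the next two relations are the definitions of `I₁`, `I₂`, `I₃` cleared of denominators,
so that the Leibniz rule alone differentiates them. -/
theorem M_eq_I (h : Adapted E W) : ∀ p ∈ W, E.M p = E.I 1 p * E.N p ^ 2 := by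
  intro p hp
  simp only [I_one]
  rw [div_mul_cancel₀ _ (pow_ne_zero 2 (h.N_ne p hp))]

theorem Om_sq_eq (h : Adapted E W) : ∀ p ∈ W, E.Om p * E.Om p = E.I 2 p * E.N p := by
  intro p hp
  simp only [I_two]
  rw [div_mul_cancel₀ _ (h.N_ne p hp), sq]

theorem cM_mul_sq (h : Adapted E W) :
    ∀ p ∈ W, E.cM p * E.N p ^ 2 = E.I 3 p * E.M p ^ 3 := by
  intro p hp
  have := h.M_ne p hp
  simp only [I_three, ← h.Gamma122_mul_M hp]
  field_simp

variable (m : ℝ)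

theorem cov_sq (E : CubicODE) (Z : Fin 2 → PlaneField) (f : PlaneField) [SmoothAt f p] :
    E.covScalarAlong (2 * m) Z (fun q => f q ^ 2) p = 2 * f p * E.covScalarAlong m Z f p := by
  simp only [sq, two_mul, E.covScalarAlong_mul m m]
  ring

theorem cov_cube (E : CubicODE) (Z : Fin 2 → PlaneField) (f : PlaneField) [SmoothAt f p] :
    E.covScalarAlong (3 * m) Z (fun q => f q ^ 3) p
      = 3 * f p ^ 2 * E.covScalarAlong m Z f p := by
  have := E.covScalarAlong_mul (f := fun q => f q ^ 2) (g := f) (p := p) (2 * m) m Z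
  rw [cov_sq] at this
  simp only [← pow_succ] at this
  rw [show 3 * m = 2 * m + m by ring, this]
  ring

/-- `∇ M` in terms of `∇ I₁` and `∇ N`, along any field. -/
theorem cov_M (h : Adapted E W) (hp : p ∈ W) (Z : Fin 2 → PlaneField) :
    E.covScalarAlong 4 Z E.M p = E.covScalarAlong 0 Z (E.I 1) p * E.N p ^ 2
      + 2 * E.I 1 p * E.N p * E.covScalarAlong 2 Z E.N p := by
  obtain ⟨⟨_, _, _⟩, _, _⟩ := h.smooth_I hp
  have := h.smooth_N p hp
  -- The weight `4` is split between `I₁`, of weight `0`, and `N²`.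
  rw [E.covScalarAlong_congr _ _ h.isOpen hp h.M_eq_I, show (4 : ℝ) = 0 + 2 * 2 by norm_num,
    covScalarAlong_mul, cov_sq]
  ring

/-- `∇ Ω` in terms of `∇ I₂` and `∇ N`, along any field. -/
theorem cov_Om (h : Adapted E W) (hp : p ∈ W) (Z : Fin 2 → PlaneField) :
    2 * E.Om p * E.covScalarAlong 1 Z E.Om p = E.covScalarAlong 0 Z (E.I 2) p * E.N p
      + E.I 2 p * E.covScalarAlong 2 Z E.N p := by
  obtain ⟨⟨_, _, _⟩, _, _⟩ := h.smooth_I hp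
  have := h.smooth_N p hp
  have := h.smooth_Om p hp
  have e := E.covScalarAlong_congr (1 + 1) Z h.isOpen hp h.Om_sq_eq
  rw [covScalarAlong_mul, show (1 + 1 : ℝ) = 0 + 2 by norm_num, covScalarAlong_mul] at e
  rw [← e]
  ring

/-- The coefficient `a` of `∇_α γ = a α + b γ` in terms of the invariants. -/
theorem aM_mul_Om (h : Adapted E W) : ∀ p ∈ W, E.aM p * E.Om p =
    E.N p ^ 2 * (E.M p * (3 * (E.I 1 p * E.I 2 p) - E.I 5 p + 18 / 5 * E.I 2 p)
      - E.Om p * E.covScalarAlong 0 E.gammaUp (E.I 1) p) := by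
  intro p hp
  have e1 := h.cov_Om hp E.alphaUp
  rw [h.alpha_eq_stepAlpha hp, ← I_five, h.alpha_N hp] at e1
  have e2 := h.Om_sq_eq p hp
  rw [h.aM_eq hp, h.cov_M hp, h.gamma_N hp]
  have e3 := h.M_eq_I p hp
  rw [e3] at e1 ⊢
  linear_combination (-E.I 1 p * E.N p ^ 2) * e1
    + (18 / 5 * E.N p * (E.I 1 p * E.N p ^ 2) + 4 * E.I 1 p ^ 2 * E.N p ^ 3) * e2

/-- The curvature identity needs `∇_α (cM)` and `∇_γ (aM)`: these come from differentiating
`cM_mul_sq` along `α` and `aM_mul_Om` along `γ`. The latter is the source of `∇_γ I₅` and `∇_γ ∇_γ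
I₁`. -/
theorem I2Bgd_eq_bgdFormula (h : Adapted E W) (hp : p ∈ W) :
    E.I2Bgd p = bgdFormula (E.I 1 p) (E.I 2 p) (E.I 3 p) (E.I 4 p) (E.I 5 p) (E.I 6 p)
      (E.Om p * E.covScalarAlong 0 E.gammaUp (E.I 1) p / E.N p ^ 2)
      (E.Om p * E.covScalarAlong 0 E.gammaUp (E.I 2) p / E.N p ^ 2)
      (E.Om p * E.covScalarAlong 0 E.gammaUp (E.I 5) p / E.N p ^ 2)
      (E.covScalarAlong 3 E.gammaUp (E.covScalarAlong 0 E.gammaUp (E.I 1)) p / E.N p ^ 3) := by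
  obtain ⟨⟨_, _, _, _⟩, ⟨_, _, _, _, _⟩, _, _, _⟩ := h.smoothAt hp
  obtain ⟨⟨_, _, _⟩, _, _⟩ := h.smooth_I hp
  have := h.smooth_M hp
  have := h.smooth_cM hp
  have := h.smooth_aM hp
  have eXM := h.cov_M hp E.alphaUp
  rw [h.alpha_eq_stepAlpha hp, ← I_four, h.alpha_N hp] at eXM
  have eYM := h.cov_M hp E.gammaUp
  rw [h.gamma_M hp, h.gamma_N hp] at eYM
  have eYOm := h.cov_Om hp E.gammaUp
  rw [h.gamma_N hp] at eYOm
  have eXcM := E.covScalarAlong_congr (8 + 2 * 2) E.alphaUp h.isOpen hp h.cM_mul_sq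
  rw [covScalarAlong_mul, cov_sq, show (8 + 2 * 2 : ℝ) = 0 + 3 * 4 by norm_num,
    covScalarAlong_mul, cov_cube, h.alpha_eq_stepAlpha hp, ← I_six, h.alpha_N hp] at eXcM
  have eYaM := E.covScalarAlong_congr (7 + 1) E.gammaUp h.isOpen hp h.aM_mul_Om
  have er : E.covScalarAlong 0 E.gammaUp
      (fun q => 3 * (E.I 1 q * E.I 2 q) - E.I 5 q + 18 / 5 * E.I 2 q) p
      = 3 * (E.covScalarAlong 0 E.gammaUp (E.I 1) p * E.I 2 p
          + E.I 1 p * E.covScalarAlong 0 E.gammaUp (E.I 2) p)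
        - E.covScalarAlong 0 E.gammaUp (E.I 5) p
        + 18 / 5 * E.covScalarAlong 0 E.gammaUp (E.I 2) p := by
    have e := E.covScalarAlong_mul (f := E.I 1) (g := E.I 2) (p := p) 0 0 E.gammaUp
    rw [add_zero] at e
    rw [covScalarAlong_add, covScalarAlong_sub, covScalarAlong_const_mul,
      covScalarAlong_const_mul, e]
  have e4 := E.covScalarAlong_mul (f := E.M)
    (g := fun q => (3 : ℝ) * (E.I 1 q * E.I 2 q) - E.I 5 q + (18 / 5 : ℝ) * E.I 2 q) (p := p)
    4 0 E.gammaUp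
  have e5 := E.covScalarAlong_mul (f := E.Om)
    (g := E.covScalarAlong 0 E.gammaUp (E.I 1)) (p := p) 1 3 E.gammaUp
  rw [er, add_zero, h.gamma_M hp] at e4
  rw [show (1 + 3 : ℝ) = 4 by norm_num] at e5
  rw [covScalarAlong_mul, show (7 + 1 : ℝ) = 2 * 2 + 4 by norm_num, covScalarAlong_mul, cov_sq,
    covScalarAlong_sub, e4, e5, h.gamma_N hp] at eYaM
  rw [h.I2Bgd_eq hp]
  refine bgdFormula_eq (YOm := E.covScalarAlong 1 E.gammaUp E.Om p) (h.N_ne p hp) (h.Om_ne p hp)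
    (h.M_ne p hp) (h.M_eq_I p hp) (by rw [sq, h.Om_sq_eq p hp]) ?_ (h.alpha_M hp) ?_
    (h.cM_mul_sq p hp) ?_ ?_ ?_ ?_
    (h.Zgamma_eq hp)
  · linear_combination eXM
  · linear_combination eYM
  · linear_combination eXcM
  · linear_combination h.aM_mul_Om p hp
  · linear_combination eYOm
  · linear_combination eYaM

theorem smooth_I2Bgd (h : Adapted E W) (hp : p ∈ W) : SmoothAt E.I2Bgd p := by
  obtain ⟨⟨_, _, _, _⟩, ⟨_, _, _, _, _⟩, _, _, _⟩ := h.smoothAt hp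
  have hZ : ∀ q ∈ W, E.I2Bgd q =
      125 / 9 * (E.Z12 q ^ 2 - E.Z11 q * E.Z22 q) / (9 * E.Om q ^ 2) := fun q hq => by
    rw [I2Bgd, h.j0_eq hq, h.j5_eq hq]
    ring
  have h11 : SmoothAt E.Z11 p := by unfold Z11 a0; infer_instance
  have h12 : SmoothAt E.Z12 p := by
    -- The division by `2` becomes a product with a constant, which instance search can handle.
    unfold Z12 a1; simp only [div_eq_mul_inv]; infer_instance
  have h22 : SmoothAt E.Z22 p := by unfold Z22 a2; infer_instance
  refine SmoothAt.congr h.isOpen hp (SmoothAt.div inferInstance inferInstance ?_) hZ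
  simpa using h.Om_ne p hp

theorem gammaSq_eq (h : Adapted E W) (f : PlaneField) : ∀ p ∈ W,
    E.covScalarAlong 0 E.gammaUp f p ^ 2 = E.stepGamma f p * E.N p ^ 3 := by
  intro p hp
  rw [stepGamma, div_mul_cancel₀ _ (pow_ne_zero 3 (h.N_ne p hp))]

/-- The normalized derivative `Ω ∇_γ f / N²` is a square root of the invariant
`I₂ (∇_γ f)² / N³`. -/
theorem normalized_sq (h : Adapted E W) (hp : p ∈ W) (f : PlaneField) :
    (E.Om p * E.covScalarAlong 0 E.gammaUp f p / E.N p ^ 2) ^ 2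
      = E.I 2 p * E.stepGamma f p := by
  have hN := h.N_ne p hp
  simp only [I_two, stepGamma]
  field_simp

theorem smooth_normalized (h : Adapted E W) (hp : p ∈ W) {f : PlaneField} (hf : SmoothAt f p) :
    SmoothAt (fun q => E.Om q * E.covScalarAlong 0 E.gammaUp f q / E.N q ^ 2) p := by
  obtain ⟨⟨_, _, _, _⟩, ⟨_, _, _, _, _⟩, _, _, _⟩ := h.smoothAt hp
  exact SmoothAt.div inferInstance inferInstance (pow_ne_zero 2 (h.N_ne p hp))

/-- The derivative of `I₇` determines `∇_γ ∇_γ I₁` where `∇_γ I₁ ≠ 0`. -/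
theorem gamma_I_seven (h : Adapted E W) (hp : p ∈ W) :
    2 * (E.Om p * E.covScalarAlong 0 E.gammaUp (E.I 1) p / E.N p ^ 2)
      * (E.covScalarAlong 3 E.gammaUp (E.covScalarAlong 0 E.gammaUp (E.I 1)) p / E.N p ^ 3)
    = E.Om p * E.covScalarAlong 0 E.gammaUp (E.I 7) p / E.N p ^ 2
      - 6 * E.I 7 p * E.I 1 p * E.I 2 p := by
  obtain ⟨⟨_, _, _, _⟩, ⟨_, _, _, _, _⟩, _, _, _⟩ := h.smoothAt hp
  obtain ⟨⟨_, _, _⟩, _, _⟩ := h.smooth_I hp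
  have hN := h.N_ne p hp
  -- Differentiate `(∇_γ I₁)² = I₇ N³` along `γ`; `∇_γ N = -2ΩM` and `Ω² = I₂ N` account for the
  -- term `6 I₇ I₁ I₂`.
  have e := E.covScalarAlong_congr (2 * 3) E.gammaUp h.isOpen hp (h.gammaSq_eq (E.I 1))
  rw [← I_seven, cov_sq, show (2 * 3 : ℝ) = 0 + 3 * 2 by norm_num, covScalarAlong_mul, cov_cube,
    h.gamma_N hp, h.M_eq_I p hp] at e
  have e2 := h.Om_sq_eq p hp
  field_simp
  linear_combination E.Om p * e - 6 * E.I 7 p * E.I 1 p * E.N p ^ 4 * e2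

end Adapted
-- Existence of the adapted frame where `b₁ ≠ 0`
section Construction

variable {E : CubicODE} {U : Set (ℝ × ℝ)} {p : ℝ × ℝ}

theorem SmoothOn.smoothAt (hE : E.SmoothOn U) (hU : IsOpen U) (hp : p ∈ U) :
    SmoothAt E.P p ∧ SmoothAt E.Q p ∧ SmoothAt E.R p ∧ SmoothAt E.S p :=
  ⟨⟨hE.1.contDiffAt (hU.mem_nhds hp)⟩, ⟨hE.2.1.contDiffAt (hU.mem_nhds hp)⟩,
    ⟨hE.2.2.1.contDiffAt (hU.mem_nhds hp)⟩, ⟨hE.2.2.2.contDiffAt (hU.mem_nhds hp)⟩⟩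

theorem SmoothOn.smooth_A (hE : E.SmoothOn U) (hU : IsOpen U) (hp : p ∈ U) : SmoothAt E.A p := by
  obtain ⟨_, _, _, _⟩ := hE.smoothAt hU hp
  unfold A; infer_instance

theorem SmoothOn.smooth_B (hE : E.SmoothOn U) (hU : IsOpen U) (hp : p ∈ U) : SmoothAt E.B p := by
  obtain ⟨_, _, _, _⟩ := hE.smoothAt hU hp
  unfold B; infer_instance

theorem SmoothOn.b1_eq_A (hE : E.SmoothOn U) (hU : IsOpen U) (hp : p ∈ U) : E.b1 p = E.A p := by
  obtain ⟨_, _, _, _⟩ := hE.smoothAt hU hp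
  have e1 := pdx_pdy_comm E.Q p
  unfold b1 a0 a1 a2 A
  simp only [pdx_add, pdx_sub, pdx_mul, pdy_add, pdy_sub, pdy_mul,
    pdy_const, pdy_sq]
  linear_combination e1

theorem SmoothOn.b2_eq_B (hE : E.SmoothOn U) (hU : IsOpen U) (hp : p ∈ U) : E.b2 p = E.B p := by
  obtain ⟨_, _, _, _⟩ := hE.smoothAt hU hp
  have e1 := pdx_pdy_comm E.R p
  unfold b2 a0 a1 a2 B
  simp only [pdx_add, pdx_sub, pdx_mul, pdx_const, pdx_sq, pdy_add, pdy_sub, pdy_mul]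
  linear_combination e1

theorem SmoothOn.isOpen_b1_ne (hE : E.SmoothOn U) (hU : IsOpen U) :
    IsOpen {p ∈ U | E.b1 p ≠ 0} := by
  have e : {p ∈ U | E.b1 p ≠ 0} = {p ∈ U | E.A p ≠ 0} := by
    ext p
    exact and_congr_right fun hp => by rw [hE.b1_eq_A hU hp]
  rw [e]
  have hA : ContinuousOn E.A U := fun p hp =>
    (hE.smooth_A hU hp).contDiffAt.continuousAt.continuousWithinAt
  exact hA.isOpen_inter_preimage hU isOpen_ne

theorem Om_apply (E : CubicODE) (p : ℝ × ℝ) :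
    E.Om p = 5 / 3 * (pdy E.phi1 p - pdx E.phi2 p) := by
  simp [Om, omega, dMat, Fin.sum_univ_two, pd, phi]
  ring

/-- On the set where `b₁ ≠ 0`, an equation of both classes has a smooth adapted frame. -/
theorem SmoothOn.adapted (hE : E.SmoothOn U) (hU : IsOpen U) (h1 : E.ShrID1 U)
    (h2 : E.BgdET2 U) : Adapted E {p ∈ U | E.b1 p ≠ 0} := by
  set W := {p ∈ U | E.b1 p ≠ 0}
  have oW : IsOpen W := hE.isOpen_b1_ne hU
  have hA : ∀ p ∈ W, E.A p ≠ 0 := fun p hp => hE.b1_eq_A hU hp.1 ▸ hp.2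
  have sP := fun p (hp : p ∈ W) => (hE.smoothAt hU hp.1).1
  have sQ := fun p (hp : p ∈ W) => (hE.smoothAt hU hp.1).2.1
  have sR := fun p (hp : p ∈ W) => (hE.smoothAt hU hp.1).2.2.1
  have sS := fun p (hp : p ∈ W) => (hE.smoothAt hU hp.1).2.2.2
  have sA := fun p (hp : p ∈ W) => hE.smooth_A hU hp.1
  have sB := fun p (hp : p ∈ W) => hE.smooth_B hU hp.1
  have eN : ∀ p ∈ W, E.N p = -E.H p / (3 * E.A p) := fun p hp => by simp [N, hA p hp]
  have e1 : ∀ p ∈ W, E.phi1 p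
      = -3 * (E.B p * E.P p + pdx E.A p) / (5 * E.A p) + 3 / 5 * E.Q p :=
    fun p hp => by simp [phi1, hA p hp]
  have e2 : ∀ p ∈ W, E.phi2 p = 3 * E.B p * (E.B p * E.P p + pdx E.A p) / (5 * E.A p ^ 2)
      - 3 * (pdx E.B p + pdy E.A p + 3 * E.B p * E.Q p) / (5 * E.A p) + 6 / 5 * E.R p :=
    fun p hp => by simp [phi2, hA p hp]
  have sN : ∀ p ∈ W, SmoothAt E.N p := fun p hp => by
    have := sP p hp; have := sQ p hp; have := sR p hp; have := sA p hp; have := sB p hp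
    refine SmoothAt.congr oW hp (SmoothAt.div ?_ inferInstance (by simp [hA p hp])) eN
    unfold H; infer_instance
  have s1 : ∀ p ∈ W, SmoothAt E.phi1 p := fun p hp => by
    have := sP p hp; have := sQ p hp; have := sA p hp; have := sB p hp
    refine SmoothAt.congr oW hp
      (SmoothAt.add (hf := SmoothAt.div inferInstance inferInstance ?_)) e1
    simp [hA p hp]
  have s2 : ∀ p ∈ W, SmoothAt E.phi2 p := fun p hp => by
    have := sP p hp; have := sQ p hp; have := sR p hp; have := sA p hp; have := sB p hp
    refine SmoothAt.congr oW hp (SmoothAt.add (hf := SmoothAt.sub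
      (hf := SmoothAt.div inferInstance inferInstance ?_)
      (hg := SmoothAt.div inferInstance inferInstance ?_))) e2 <;> simp [hA p hp]
  have sO : ∀ p ∈ W, SmoothAt E.Om p := fun p hp => by
    have := s1 p hp; have := s2 p hp
    rw [funext E.Om_apply]; infer_instance
  -- The formulas for `φ`, solved for derivatives of `α`, give `∂A/∂x` and only the sum `∂B/∂x +
  -- ∂A/∂y`. A second combination of these two is supplied by `H`, that is, by `N`.
  have ePhi1 : ∀ p ∈ W, E.B p * E.P p + pdx E.A p
      = E.A p * E.Q p - 5 / 3 * E.A p * E.phi1 p := fun p hp => by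
    have := hA p hp
    rw [e1 p hp]; field_simp; ring
  have ePhi2 : ∀ p ∈ W, pdx E.B p + pdy E.A p
      = 2 * E.A p * E.R p - 2 * E.B p * E.Q p - 5 / 3 * E.B p * E.phi1 p
        - 5 / 3 * E.A p * E.phi2 p := fun p hp => by
    have := hA p hp
    rw [e2 p hp, ePhi1 p hp]; field_simp; ring
  have eH : ∀ p ∈ W, E.H p = -3 * E.N p * E.A p := fun p hp => by
    have := hA p hp
    rw [eN p hp]; field_simp
  -- `F = 0` says `A G + B H = 0`; with `H = -3NA` and `A ≠ 0` this gives `G`.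
  have eG : ∀ p ∈ W, E.G p = 3 * E.N p * E.B p := fun p hp => by
    have e := E.F_pow_five p
    rw [(h1 p hp.1).1, eH p hp] at e
    apply mul_left_cancel₀ (hA p hp)
    linear_combination -e
  have eg1 : ∀ p ∈ W, E.gamma1 p
      = -pdx E.N p - 2 * E.phi1 p * E.N p - 2 * E.Om p * E.A p := fun p hp => by
    have := hA p hp
    simp only [gamma1, hA p hp, ne_eq, not_false_eq_true, if_true]
    rw [ePhi1 p hp]; field_simp; ring
  have eg2 : ∀ p ∈ W, E.gamma2 p
      = -pdy E.N p - 2 * E.phi2 p * E.N p - 2 * E.Om p * E.B p := fun p hp => by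
    have := hA p hp
    simp only [gamma2, hA p hp, ne_eq, not_false_eq_true, if_true]
    rw [ePhi1 p hp, ePhi2 p hp]; field_simp; ring
  refine
    { isOpen := oW
      smooth_P := sP
      smooth_Q := sQ
      smooth_R := sR
      smooth_S := sS
      smooth_A := sA
      smooth_B := sB
      smooth_N := sN
      smooth_phi1 := s1
      smooth_phi2 := s2
      smooth_Om := sO
      smooth_gamma1 := fun p hp => by
        have := sN p hp; have := s1 p hp; have := sO p hp; have := sA p hp
        exact SmoothAt.congr oW hp inferInstance eg1
      smooth_gamma2 := fun p hp => by
        have := sN p hp; have := s2 p hp; have := sO p hp; have := sB p hp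
        exact SmoothAt.congr oW hp inferInstance eg2
      A_ne := hA
      M_ne := fun p hp => (h1 p hp.1).2.2
      N_ne := fun p hp => (h2 p hp.1).2.2.2
      Om_ne := fun p hp => (h2 p hp.1).2.2.1
      A_x := fun p hp => by linear_combination ePhi1 p hp
      A_y := fun p hp => by
        have e3 := eH p hp
        simp only [H] at e3
        apply mul_left_cancel₀ (hA p hp)
        linear_combination 4 / 5 * E.A p * ePhi2 p hp - 1 / 5 * e3 - 3 / 5 * E.B p * ePhi1 p hp
      B_x := fun p hp => by
        have e3 := eH p hp
        simp only [H] at e3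
        apply mul_left_cancel₀ (hA p hp)
        linear_combination 1 / 5 * E.A p * ePhi2 p hp + 1 / 5 * e3 + 3 / 5 * E.B p * ePhi1 p hp
      B_y := fun p hp => ?_
      N_x := fun p hp => by rw [eg1 p hp]; ring
      N_y := fun p hp => by rw [eg2 p hp]; ring
      M_eq := fun p hp => by
        have := hA p hp
        simp only [M, hA p hp, ne_eq, not_false_eq_true, if_true]
        rw [ePhi1 p hp, eg1 p hp, eg2 p hp]
        field_simp
        linear_combination 18 * E.N p * ePhi2 p hp
      Om_eq := fun p _ => E.Om_apply p
      b1_eq := fun p hp => hE.b1_eq_A hU hp.1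
      b2_eq := fun p hp => hE.b2_eq_B hU hp.1 }
  -- In `A G + B H` the derivatives of `α` enter only as `∂A/∂x`, `∂B/∂y` and `∂B/∂x + ∂A/∂y`, so
  -- its vanishing is the remaining equation, for `∂B/∂y`.
  have e3 := eH p hp
  have e4 := eG p hp
  simp only [H] at e3
  simp only [G] at e4
  apply mul_left_cancel₀ (pow_ne_zero 2 (hA p hp))
  linear_combination -1 / 3 * E.A p * e4 - 1 / 3 * E.B p * e3
    + E.A p * E.B p * ePhi2 p hp - E.B p ^ 2 * ePhi1 p hp

end Construction
end CubicODE

/-! ### Values of radical expressions -/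

namespace RadExpr

instance : Add RadExpr := ⟨.add⟩

instance : Mul RadExpr := ⟨.mul⟩

namespace Value

variable {v : ℕ → PlaneField} {W : Set (ℝ × ℝ)} {a b e : RadExpr} {f g : PlaneField}

theorem congr (h : Value v W e f) (hfg : ∀ p ∈ W, g p = f p) : Value v W e g := by
  cases e with
  | const q => exact fun p hp => (hfg p hp).trans (h p hp)
  | var k => exact fun p hp => (hfg p hp).trans (h p hp)
  | add a b =>
    obtain ⟨f₁, f₂, h₁, h₂, h⟩ := h
    exact ⟨f₁, f₂, h₁, h₂, fun p hp => (hfg p hp).trans (h p hp)⟩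
  | mul a b =>
    obtain ⟨f₁, f₂, h₁, h₂, h⟩ := h
    exact ⟨f₁, f₂, h₁, h₂, fun p hp => (hfg p hp).trans (h p hp)⟩
  | inv a =>
    obtain ⟨f₁, h₁, h⟩ := h
    exact ⟨f₁, h₁, fun p hp => ⟨(h p hp).1, (hfg p hp).trans (h p hp).2⟩⟩
  | sqrt a =>
    obtain ⟨f₁, h₁, hc, h⟩ := h
    exact ⟨f₁, h₁, hc.congr hfg, fun p hp => by rw [hfg p hp, h p hp]⟩

theorem const (q : ℚ) : Value v W (.const q) fun _ => q := fun _ _ => rfl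

theorem var (k : ℕ) : Value v W (.var k) fun p => v k p := fun _ _ => rfl

theorem add (ha : Value v W a f) (hb : Value v W b g) :
    Value v W (a + b) fun p => f p + g p := ⟨f, g, ha, hb, fun _ _ => rfl⟩

theorem mul (ha : Value v W a f) (hb : Value v W b g) :
    Value v W (a * b) fun p => f p * g p := ⟨f, g, ha, hb, fun _ _ => rfl⟩

theorem inv (ha : Value v W a f) (h : ∀ p ∈ W, f p ≠ 0) :
    Value v W (.inv a) fun p => (f p)⁻¹ := ⟨f, ha, fun p hp => ⟨h p hp, rfl⟩⟩

/-- The branch of the root is free, so any continuous function with the right square may be taken.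
-/
theorem sqrt_mul_var {j k : ℕ} (hc : ContinuousOn g W) (h : ∀ p ∈ W, g p ^ 2 = v j p * v k p) :
    Value v W (.sqrt (.var j * .var k)) g := ⟨_, (var j).mul (var k), hc, h⟩

end Value

/-- The expression of `CubicODE.bgdFormula` in the variables `X₁, …, X₆`, with expressions
substituted for the remaining four arguments. -/
def bgdExpr (s s2 s5 t : RadExpr) : RadExpr :=
  let r := const 3 * var 1 * var 2 + const (-1) * var 5 + const (18 / 5) * var 2
  let y := s * inv (var 1)
  let d := y + const (-4) * var 1 * var 2
  let a := r + const (-1) * y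
  const (5 / 4) + const (-25 / 3) * (var 6 * var 1 * var 1 + const 2 * var 3 * var 1 * var 4
    + const 2 * var 3 * var 1 * var 1 * var 1
    + const (-1) * (const 2 * var 4 + const 4 * var 1 * var 1 + const (12 / 5) * var 1)
      * var 3 * var 1
    + (d * a + const (-1) * a * a + const (-3) * s * var 2 + const (-3) * var 1 * s2 + s5
      + const (-18 / 5) * s2 + const 3 * r * var 1 * var 2) * inv (var 2)
    + const (1 / 2) * r * s2 * inv (var 2) * inv (var 2) + t * inv (var 1)
    + const (-1) * y * y * inv (var 2)) * inv (var 1) * inv (var 2)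

theorem value_bgdExpr {v : ℕ → PlaneField} {W : Set (ℝ × ℝ)} {s s2 s5 t : RadExpr}
    {fs fs2 fs5 ft : PlaneField} (h1 : ∀ p ∈ W, v 1 p ≠ 0) (h2 : ∀ p ∈ W, v 2 p ≠ 0)
    (hs : Value v W s fs) (hs2 : Value v W s2 fs2) (hs5 : Value v W s5 fs5)
    (ht : Value v W t ft) :
    Value v W (bgdExpr s s2 s5 t) fun p => CubicODE.bgdFormula (v 1 p) (v 2 p) (v 3 p) (v 4 p)
      (v 5 p) (v 6 p) (fs p) (fs2 p) (fs5 p) (ft p) := by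
  have i1 := (Value.var (v := v) 1).inv h1
  have i2 := (Value.var (v := v) 2).inv h2
  -- The function is left open here: it is assembled by unification along the expression and only
  -- then compared with the formula.
  apply Value.congr
  · dsimp only [bgdExpr]
    repeat' first
      | exact hs | exact hs2 | exact hs5 | exact ht | exact i1 | exact i2
      | exact Value.const _ | exact Value.var _ | apply Value.mul | apply Value.add
  · intro p hp
    have := h1 p hp
    have := h2 p hp
    unfold CubicODE.bgdFormula
    push_cast
    field_simp
    ring

end RadExpr

/-! ### The two universal expressions -/

theorem theorem8p1 :
    ∃ e₁ e₂ : RadExpr, ∀ (E : CubicODE) (U : Set (ℝ × ℝ)), IsOpen U → E.SmoothOn U →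
      E.ShrID1 U → E.BgdET2 U →
        (∀ p ∈ U, E.b1 p ≠ 0 →
          E.j0 p ≠ 0 ∧ E.I2Bgd p = E.j5 p / (9 * E.Om p ^ 2) ∧ ContinuousAt E.I2Bgd p ∧
          p ∈ closure ({q ∈ U | E.b1 q ≠ 0 ∧ E.I 7 q ≠ 0} ∪
            interior {q ∈ U | E.b1 q ≠ 0 ∧ E.I 7 q = 0})) ∧
        RadExpr.Value E.I {p ∈ U | E.b1 p ≠ 0 ∧ E.I 7 p ≠ 0} e₁ E.I2Bgd ∧
        RadExpr.Value E.I (interior {p ∈ U | E.b1 p ≠ 0 ∧ E.I 7 p = 0}) e₂ E.I2Bgd := by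
  -- `s k` stands for `Ω ∇_γ I_j / N²`, where `I_k` arises from `I_j` by the `γ`-step: `j = 1, 2, 5,
  -- 7` for `k = 7, 8, 14, 19`. The last argument of the first expression is `gamma_I_seven` solved
  -- for the second derivative.
  let s : ℕ → RadExpr := fun k => .sqrt (.var 2 * .var k)
  refine ⟨.bgdExpr (s 7) (s 8) (s 14) ((s 19 + .const (-6) * .var 7 * .var 1 * .var 2)
    * .inv (.const 2 * s 7)), .bgdExpr (.const 0) (s 8) (s 14) (.const 0), ?_⟩
  intro E U hU hE hS hB
  have h := hE.adapted hU hS hB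
  set W := {p ∈ U | E.b1 p ≠ 0}
  have hI1 : ∀ p ∈ W, E.I 1 p ≠ 0 := fun p hp => by
    simpa [E.I_one] using ⟨h.M_ne p hp, h.N_ne p hp⟩
  have hI2 : ∀ p ∈ W, E.I 2 p ≠ 0 := fun p hp => by
    simpa [E.I_two] using ⟨h.Om_ne p hp, h.N_ne p hp⟩
  have sub1 : {p ∈ U | E.b1 p ≠ 0 ∧ E.I 7 p ≠ 0} ⊆ W := fun p hp => ⟨hp.1, hp.2.1⟩
  have sub2 : interior {p ∈ U | E.b1 p ≠ 0 ∧ E.I 7 p = 0} ⊆ W := fun p hp =>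
    ⟨(interior_subset hp).1, (interior_subset hp).2.1⟩
  have hsqrt : ∀ (V : Set (ℝ × ℝ)) (j k : ℕ), V ⊆ W → (∀ p ∈ W, SmoothAt (E.I j) p) →
      E.I k = E.stepGamma (E.I j) → RadExpr.Value E.I V (s k)
        fun p => E.Om p * E.covScalarAlong 0 E.gammaUp (E.I j) p / E.N p ^ 2 := by
    intro V j k hV hj hk
    refine RadExpr.Value.sqrt_mul_var (fun p hp => ?_) fun p hp => ?_
    · exact (h.smooth_normalized (hV hp)
        (hj p (hV hp))).contDiffAt.continuousAt.continuousWithinAt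
    · rw [hk]
      exact h.normalized_sq (hV hp) _
  refine ⟨fun p hp hb => ?_, ?_, ?_⟩
  · have hpW : p ∈ W := ⟨hp, hb⟩
    have hO := h.Om_ne p hpW
    refine ⟨?_, ?_, ?_, ?_⟩
    · rw [h.j0_eq hpW]
      simpa using hO
    · rw [CubicODE.I2Bgd, h.j0_eq hpW]
      ring
    · exact (h.smooth_I2Bgd hpW).contDiffAt.continuousAt
    · by_contra hc
      rw [closure_union, Set.mem_union, not_or] at hc
      refine hc.2 (subset_closure ?_)
      -- A point of `D` outside the closure of `D₁` has a neighbourhood in `D` on which `I₇ = 0`,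
      -- hence lies in the interior.
      have hn : (closure {q ∈ U | E.b1 q ≠ 0 ∧ E.I 7 q ≠ 0})ᶜ ∩ W ∈ nhds p :=
        Filter.inter_mem (isClosed_closure.isOpen_compl.mem_nhds hc.1) (h.isOpen.mem_nhds hpW)
      rw [mem_interior_iff_mem_nhds]
      filter_upwards [hn] with q hq
      refine ⟨hq.2.1, hq.2.2, ?_⟩
      by_contra h7
      exact hq.1 (subset_closure ⟨hq.2.1, hq.2.2, h7⟩)
  · have v7 := hsqrt _ 1 7 sub1 (fun p hp => (h.smooth_I hp).1.1) E.I_seven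
    have v8 := hsqrt _ 2 8 sub1 (fun p hp => (h.smooth_I hp).1.2.1) E.I_eight
    have v14 := hsqrt _ 5 14 sub1 (fun p hp => (h.smooth_I hp).2.1) E.I_fourteen
    have v19 := hsqrt _ 7 19 sub1 (fun p hp => (h.smooth_I hp).2.2) E.I_nineteen
    have hne : ∀ p ∈ {p ∈ U | E.b1 p ≠ 0 ∧ E.I 7 p ≠ 0},
        E.Om p * E.covScalarAlong 0 E.gammaUp (E.I 1) p / E.N p ^ 2 ≠ 0 := by
      intro p hp h0
      have e := h.normalized_sq (sub1 hp) (E.I 1)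
      rw [h0, ← E.I_seven] at e
      have := mul_ne_zero (hI2 p (sub1 hp)) hp.2.2
      exact this (by rw [← e]; ring)
    have vt := (v19.add ((((RadExpr.Value.const (-6)).mul (.var 7)).mul (.var 1)).mul
      (.var 2))).mul (((RadExpr.Value.const 2).mul v7).inv fun p hp => by
        simpa using hne p hp)
    refine (RadExpr.value_bgdExpr (fun p hp => hI1 p (sub1 hp)) (fun p hp => hI2 p (sub1 hp))
      v7 v8 v14 vt).congr fun p hp => ?_
    rw [h.I2Bgd_eq_bgdFormula (sub1 hp)]
    congr 1
    have e := h.gamma_I_seven (sub1 hp)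
    have := hne p hp
    push_cast
    rw [eq_mul_inv_iff_mul_eq₀ (mul_ne_zero two_ne_zero this)]
    linear_combination e
  · have v8 := hsqrt _ 2 8 sub2 (fun p hp => (h.smooth_I hp).1.2.1) E.I_eight
    have v14 := hsqrt _ 5 14 sub2 (fun p hp => (h.smooth_I hp).2.1) E.I_fourteen
    refine (RadExpr.value_bgdExpr (fun p hp => hI1 p (sub2 hp)) (fun p hp => hI2 p (sub2 hp))
      (.const 0) v8 v14 (.const 0)).congr fun p hp => ?_
    -- Here `I₇ = 0` forces `∇_γ I₁ = 0`. Because this holds on an open set, the second derivative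
    -- vanishes too.
    have h0 : ∀ q ∈ interior {p ∈ U | E.b1 p ≠ 0 ∧ E.I 7 p = 0},
        E.covScalarAlong 0 E.gammaUp (E.I 1) q = (fun _ => (0 : ℝ)) q := by
      intro q hq
      have e := h.gammaSq_eq (E.I 1) q (sub2 hq)
      rw [← E.I_seven, (interior_subset hq).2.2, zero_mul] at e
      exact pow_eq_zero_iff two_ne_zero |>.1 e
    rw [h.I2Bgd_eq_bgdFormula (sub2 hp), h0 p hp,
      E.covScalarAlong_congr 3 E.gammaUp isOpen_interior hp h0]
    simp [CubicODE.covScalarAlong, CubicODE.covScalar, pd, pdx_const, pdy_const]
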